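/- All lattices are finite. The cover graph $C(P)$ of a finite poset $P$ has the elements of $P$ as vertices and the coverings $x\prec y$ as edges; the nullity of $P$ is (number of edges) $-$ (number of vertices) $+$ (number of connected components) of $C(P)$. In a poset $P$ let $\mathrm{Irr}(P)$ be the set of elements with at most one lower and at most one upper cover, $\mathrm{Irr}^*(P)$ the set of elements with exactly one lower and exactly one upper cover, and $\mathrm{Red}(P)=P\setminus\mathrm{Irr}(P)$. In a lattice, an element $a$ is meet-reducible (join-reducible) if $a=\inf\{b,c\}$ ($a=\sup\{b,c\}$) for some $b,c\neq a$, and reducible if it is one or the other. A block is a finite lattice whose largest element is join-reducible and whose smallest element is meet-reducible. An element $x\in\mathrm{Irr}(P)$ is retractible in $P$ if either there are no $y,z\in\mathrm{Red}(P)$ with $y\prec x\prec z$, or there are such $y,z$ and $y\prec x\prec z$ is the only directed path from $y$ to $z$ in the cover graph. A basic block associated to $P$ is a subposet obtained from $P$ by first successively removing elements of $\mathrm{Irr}^*$ that are retractible in the current subposet until there are none left, and then successively removing pendant vertices of the cover graph (vertices of degree one) until there are none left. The height of a poset is the maximal number of coverings in a chain. Let $\mathscr{B}(j;4,3,4)$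 be the class of all blocks, up to isomorphism, with $j$ elements, exactly four reducible elements, these being pairwise comparable, and nullity three, whose associated basic block has height four. For pairs $(a_k,b_k)$, $k=1,2,3$, of elements of the chain $0\prec1\prec2\prec3\prec4$ with $a_k<b_k$, let $[a_1b_1,a_2b_2,a_3b_3]$ be the poset consisting of this chain and three more elements $c_1,c_2,c_3$, where for chain elements $u,v$ one has $u\le c_k$ iff $u\le a_k$, $c_k\le v$ iff $b_k\le v$, and $c_k\le c_l$ iff $k=l$ or $b_k\le a_l$. Put $$B_4=[13,13,04],\quad B_5=[13,04,04],\quad B_6=[14,24,02],\quad B_7=[03,02,24],\quad B_8=[14,24,04],$$ $$B_9=[03,02,04],\quad B_{10}=[13,03,04],\quad B_{11}=[13,14,04],\quad B_{12}=[13,03,14].$$ For $4\le i\le 12$ let $\mathbb{B}_i(j;4,3)$ be the class of all blocks, up to isomorphism, with $j$ elements, exactly four reducible elements, these being pairwise comparable, and nullity three, whose associated basic block is isomorphic to $B_i$. Let $P_n^k$ be the number of partitions of $n$ into exactly $k$ positive integer parts. Theorem. For every integer $j\ge 8$, $$|\mathscr{B}(j;4,3,4)|=\sum_{i=4}^{12}|\mathbb{B}_i(j;4,3)|=\sum_{t=1}^{j-7}\sum_{i=2}^{j-t-5}(i-1)P^{3}_{j-t-i-2}+\sum_{p=4}^{j-4}\sum_{t=1}^{j-p-3}t\,P^{2}_{j-p-t-1}P^{2}_{p-2}+\sum_{t=1}^{j-7}\sum_{r=1}^{j-t-6}\sum_{l=1}^{j-t-r-5}\sum_{i=1}^{j-t-r-l-4}7P^{2}_{j-t-r-l-i-2}.$$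 -/

import Mathlib

/-! ### Cover relations, irreducible elements, nullity -/

section Poset

variable {α : Type*} [PartialOrder α]

/-- `x ∈ Irr(P)`: at most one lower cover and at most one upper cover. -/
def IsIrr (x : α) : Prop :=
  {y : α | y ⋖ x}.Subsingleton ∧ {y : α | x ⋖ y}.Subsingleton

/-- `x ∈ Irr*(P)`: exactly one lower cover and exactly one upper cover. -/
def IsIrrStar (x : α) : Prop :=
  (∃! y : α, y ⋖ x) ∧ ∃! y : α, x ⋖ y

/-- `x ∈ Red(P)`, the complement of `Irr(P)`. -/
def IsRed (x : α) : Prop := ¬ IsIrr x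

/-- A doubly irreducible element `x` is retractible if there are no reducible `y ⋖ x ⋖ z`, or there
are such `y`, `z` and `y, x, z` is the only directed path from `y` to `z` in the cover graph. -/
def IsRetractible (x : α) : Prop :=
  IsIrr x ∧
    ((¬ ∃ y z : α, IsRed y ∧ IsRed z ∧ y ⋖ x ∧ x ⋖ z) ∨
      ∃ y z : α, IsRed y ∧ IsRed z ∧ y ⋖ x ∧ x ⋖ z ∧
        ∀ l : List α, l.IsChain (· ⋖ ·) → l.head? = some y → l.getLast? = some z → l = [y, x, z])

/-- A pendant vertex of the cover graph. -/
def IsPendant (x : α) : Prop := ((SimpleGraph.hasse α).neighborSet x).ncard = 1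

variable (α) in
/-- No element of `Irr*(P)` is retractible. -/
def IsBasicRetract : Prop := ∀ x : α, IsIrrStar x → ¬ IsRetractible x

/-- The subposet `T` arises from the subposet `S` by removing one element of `Irr*(S)` that is
retractible in `S`. -/
def RetractStep (S T : Set α) : Prop :=
  ∃ x : S, IsIrrStar x ∧ IsRetractible x ∧ T = S \ {(x : α)}

/-- The subposet `T` arises from the subposet `S` by removing one pendant vertex of `S`. -/
def PendantStep (S T : Set α) : Prop :=
  ∃ x : S, IsPendant x ∧ T = S \ {(x : α)}

/-- `R` is a basic retract associated to the poset `α`. -/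
def IsAssociatedBasicRetract (R : Set α) : Prop :=
  Relation.ReflTransGen RetractStep Set.univ R ∧ IsBasicRetract R

/-- `B` is a basic block associated to the poset `α`: it is obtained from an associated basic
retract by successive removal of all pendant vertices. -/
def IsAssociatedBasicBlock (B : Set α) : Prop :=
  ∃ R : Set α, IsAssociatedBasicRetract R ∧ Relation.ReflTransGen PendantStep R B ∧
    ∀ x : B, ¬ IsPendant x

variable (α) in
/-- The basic block associated to `α` has height `h`, the length of its longest chains. -/
def HasBasicBlockOfHeight (h : ℕ) : Prop :=
  ∃ B : Set α, IsAssociatedBasicBlock B ∧ Order.krullDim B = (h : WithBot ℕ∞)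

variable (α) in
/-- The basic block associated to `α` is (isomorphic to) `β`. -/
def HasBasicBlock (β : Type*) [PartialOrder β] : Prop :=
  ∃ B : Set α, IsAssociatedBasicBlock B ∧ Nonempty (B ≃o β)

variable (α) in
/-- Nullity of the cover graph: number of edges minus number of vertices plus number of connected
components (for finite `α`). -/
noncomputable def nullity : ℤ :=
  ((SimpleGraph.hasse α).edgeSet.ncard : ℤ) - (Nat.card α : ℤ) +
    (Nat.card (SimpleGraph.hasse α).ConnectedComponent : ℤ)

end Poset

/-! ### Reducible elements of lattices, blocks -/

section Lattice

variable {α : Type*} [Lattice α]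

def IsMeetReducible (a : α) : Prop := ∃ b c : α, b ≠ a ∧ c ≠ a ∧ b ⊓ c = a

def IsJoinReducible (a : α) : Prop := ∃ b c : α, b ≠ a ∧ c ≠ a ∧ b ⊔ c = a

def IsReducible (a : α) : Prop := IsMeetReducible a ∨ IsJoinReducible a

variable (α) in
/-- The largest element is join-reducible and the smallest element is meet-reducible. -/
def IsBlock : Prop :=
  (∃ t : α, IsTop t ∧ IsJoinReducible t) ∧ ∃ b : α, IsBot b ∧ IsMeetReducible b

variable (α) in
/-- A block with exactly `r` reducible elements, which are pairwise comparable, and nullity `k`. -/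
def IsRCBlock (r k : ℕ) : Prop :=
  IsBlock α ∧ {a : α | IsReducible a}.ncard = r ∧ IsChain (· ≤ ·) {a : α | IsReducible a} ∧
    nullity α = (k : ℤ)

end Lattice

/-! ### The nine basic blocks of height four -/

/-- The adjunct pairs of `B₄, …, B₁₂` (in this order) over the chain `0 < 1 < 2 < 3 < 4`. -/
def adjunctPairs : Fin 9 → Fin 3 → Fin 5 × Fin 5 :=
  ![![(1, 3), (1, 3), (0, 4)],
    ![(1, 3), (0, 4), (0, 4)],
    ![(1, 4), (2, 4), (0, 2)],
    ![(0, 3), (0, 2), (2, 4)],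
    ![(1, 4), (2, 4), (0, 4)],
    ![(0, 3), (0, 2), (0, 4)],
    ![(1, 3), (0, 3), (0, 4)],
    ![(1, 3), (1, 4), (0, 4)],
    ![(1, 3), (0, 3), (1, 4)]]

theorem adjunctPairs_lt : ∀ i k, (adjunctPairs i k).1 < (adjunctPairs i k).2 := by decide

/-- The elements of `B_{i+4}`: a chain of five elements and three further elements `c_k`. -/
inductive HeightFourBlock (i : Fin 9) : Type
  | chain (u : Fin 5) : HeightFourBlock i
  | extra (k : Fin 3) : HeightFourBlock i

namespace HeightFourBlock

/-- The order of the iterated adjunct `C ]_{a₁}^{b₁} {c₁} ]_{a₂}^{b₂} {c₂} ]_{a₃}^{b₃} {c₃}`. -/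
def le (i : Fin 9) : HeightFourBlock i → HeightFourBlock i → Prop
  | chain u, chain v => u ≤ v
  | chain u, extra k => u ≤ (adjunctPairs i k).1
  | extra k, chain v => (adjunctPairs i k).2 ≤ v
  | extra k, extra l => k = l ∨ (adjunctPairs i k).2 ≤ (adjunctPairs i l).1

instance (i : Fin 9) : PartialOrder (HeightFourBlock i) where
  le := le i
  le_refl x := by cases x <;> simp [le]
  le_trans x y z := by
    have h := adjunctPairs_lt i
    rcases x with u | k <;> rcases y with v | l <;> rcases z with w | m <;> simp only [le] <;>
      grind
  le_antisymm x y := by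
    have h := adjunctPairs_lt i
    rcases x with u | k <;> rcases y with v | l <;> simp only [le] <;> grind

end HeightFourBlock

/-! ### Isomorphism classes of lattices on `j` elements -/

/-- Order isomorphism of lattice structures on `Fin j`. -/
def latticeSetoid (j : ℕ) : Setoid (Lattice (Fin j)) where
  r L M := Nonempty (@OrderIso (Fin j) (Fin j) L.toLE M.toLE)
  iseqv :=
    { refl := fun L => ⟨@OrderIso.refl (Fin j) L.toLE⟩
      symm := fun {L M} ⟨e⟩ => ⟨@OrderIso.symm (Fin j) (Fin j) L.toLE M.toLE e⟩
      trans := fun {L M N} ⟨e⟩ ⟨f⟩ =>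
        ⟨@OrderIso.trans (Fin j) (Fin j) (Fin j) L.toLE M.toLE N.toLE e f⟩ }

/-- Lattices on `j` elements up to isomorphism. -/
def LatticeClass (j : ℕ) : Type := Quotient (latticeSetoid j)

/-- `𝓑(j; r, k, h)`: the isomorphism classes of blocks on `j` elements with exactly `r` reducible
elements, all comparable, and nullity `k`, whose associated basic block has height `h`. -/
def blockClass (j r k h : ℕ) : Set (LatticeClass j) :=
  Quotient.mk (latticeSetoid j) '' {L | @IsRCBlock (Fin j) L r k ∧
    @HasBasicBlockOfHeight (Fin j) L.toPartialOrder h}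

/-- `𝔹_{i+4}(j; 4, 3)`: the isomorphism classes of blocks on `j` elements with exactly four
reducible elements, all comparable, and nullity three, whose associated basic block is `B_{i+4}`. -/
def typedBlockClass (i : Fin 9) (j : ℕ) : Set (LatticeClass j) :=
  Quotient.mk (latticeSetoid j) '' {L | @IsRCBlock (Fin j) L 4 3 ∧
    @HasBasicBlock (Fin j) L.toPartialOrder (HeightFourBlock i) _}

/-- `P_n^k`: the number of partitions of `n` into exactly `k` positive parts. -/
def numPartitions (k n : ℕ) : ℕ :=
  (Finset.univ.filter fun p : n.Partition => p.parts.card = k).card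

/-! Let r₀ < r₁ < r₂ < r₃ be the reducible elements of such a block; r₀ and r₃ are its bottom and
top. An irreducible element x has a largest reducible element below it and a smallest one above it,
so it belongs to one of the six pairs of these nodes. In a lattice, two elements below an
irreducible one are comparable unless their join is a reducible element under it, and dually. Hence
the irreducible elements of each pair split into disjoint chains, called strands here, which
interact only through the nodes. Every such block therefore embeds in the universal poset `Frame`
(`exists_reduced_embedding`). Up to isomorphism it is the same thing as six multisets of strand
sizes, subject to the condition that all four nodes are reducible (`nonempty_orderIso_of_sizes_eq`,
`Reduced.sizes_eq_of_orderIso`).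

The invariants depend only on the numbers of strands. Counting coverings shows that the nullity is
the number of strands plus the number of empty consecutive pairs minus 3 (`nullity_of_orderIso`). An
element of a strand is retractible exactly if its strand has another element, or if the strand is
the only one between two consecutive nodes (`Reduced.isRetractible_link_iff`). Removing it does not
change the vector `core`. So every maximal sequence of retractions ends with `core q` singleton
strands for each pair q, no vertex is pendant at that point, and the basic block is determined by
`core`. Its height is 3 plus the number of consecutive pairs with at least two strands
(`krullDim_of_sizes`).

Height four means that exactly one consecutive pair has at least two strands. Together with nullity
three and the reducibility of every node this leaves nine vectors, which are those of B₄, …, B₁₂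
(`exists_core_eq_iff`).

For a fixed vector, a consecutive pair with core 0 has at most one strand, with generating function
1/(1-x). Any other pair with core k contributes the generating function of partitions into k parts.
In each type exactly two consecutive pairs are of the first kind. With P_k for the partition series,
the products are P₃P₁/(1-x)² and P₂²/(1-x)², once each, and P₂P₁²/(1-x)², seven times. The three
nested sums are the coefficients of these series in degree j-4. -/

section FinitePoset

/-! ### Order-theoretic reformulations and invariance under isomorphism -/

variable {α β : Type*} [PartialOrder α] [PartialOrder β]

/-- `a` is the join of two strictly smaller elements. -/
def IsProperJoin (a : α) : Prop := ∃ b c : α, b < a ∧ c < a ∧ ∀ z, b ≤ z → c ≤ z → a ≤ z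

/-- `a` is the meet of two strictly larger elements. -/
def IsProperMeet (a : α) : Prop := ∃ b c : α, a < b ∧ a < c ∧ ∀ z, z ≤ b → z ≤ c → z ≤ a

theorem OrderIso.isProperJoin_iff (e : α ≃o β) {a : α} : IsProperJoin (e a) ↔ IsProperJoin a := by
  constructor
  · rintro ⟨b, c, hb, hc, h⟩
    refine ⟨e.symm b, e.symm c, by simpa [e.symm_apply_lt] using hb,
      by simpa [e.symm_apply_lt] using hc, fun z hbz hcz => ?_⟩
    rw [← e.le_iff_le]
    exact h _ (e.symm_apply_le.1 hbz) (e.symm_apply_le.1 hcz)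
  · rintro ⟨b, c, hb, hc, h⟩
    refine ⟨e b, e c, by simpa using hb, by simpa using hc, fun z hbz hcz => ?_⟩
    rw [← e.le_symm_apply] at *
    exact h _ hbz hcz

theorem OrderIso.isProperMeet_iff (e : α ≃o β) {a : α} : IsProperMeet (e a) ↔ IsProperMeet a := by
  constructor
  · rintro ⟨b, c, hb, hc, h⟩
    refine ⟨e.symm b, e.symm c, by simpa [e.lt_symm_apply] using hb,
      by simpa [e.lt_symm_apply] using hc, fun z hbz hcz => ?_⟩
    rw [← e.le_iff_le]
    exact h _ (e.le_symm_apply.1 hbz) (e.le_symm_apply.1 hcz)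
  · rintro ⟨b, c, hb, hc, h⟩
    refine ⟨e b, e c, by simpa using hb, by simpa using hc, fun z hbz hcz => ?_⟩
    rw [← e.symm_apply_le] at *
    exact h _ hbz hcz

/-- If there were only one lower cover, finiteness would put both witnesses below it, so it would be
an upper bound that is not above their join. -/
theorem IsProperJoin.isRed [Finite α] {a : α} (h : IsProperJoin a) : IsRed a := by
  obtain ⟨b, c, hb, hc, h⟩ := h
  obtain ⟨b', hb', hba⟩ := exists_le_covBy_of_lt hb
  obtain ⟨c', hc', hca⟩ := exists_le_covBy_of_lt hc
  intro hi
  obtain rfl : b' = c' := hi.1 hba hca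
  exact (h b' hb' hc').not_gt hba.lt

theorem IsProperMeet.isRed [Finite α] {a : α} (h : IsProperMeet a) : IsRed a := by
  obtain ⟨b, c, hb, hc, h⟩ := h
  obtain ⟨b', hba, hb'⟩ := exists_covBy_le_of_lt hb
  obtain ⟨c', hca, hc'⟩ := exists_covBy_le_of_lt hc
  intro hi
  obtain rfl : b' = c' := hi.2 hba hca
  exact (h b' hb' hc').not_gt hba.lt

theorem OrderIso.isIrr_iff (e : α ≃o β) {a : α} : IsIrr (e a) ↔ IsIrr a := by
  constructor
  · rintro ⟨h1, h2⟩
    refine ⟨fun y hy z hz => ?_, fun y hy z hz => ?_⟩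
    · exact e.injective (h1 ((apply_covBy_apply_iff e).2 hy) ((apply_covBy_apply_iff e).2 hz))
    · exact e.injective (h2 ((apply_covBy_apply_iff e).2 hy) ((apply_covBy_apply_iff e).2 hz))
  · rintro ⟨h1, h2⟩
    refine ⟨e.surjective.forall.2 fun y hy => e.surjective.forall.2 fun z hz => ?_,
      e.surjective.forall.2 fun y hy => e.surjective.forall.2 fun z hz => ?_⟩
    · exact congrArg e (h1 ((apply_covBy_apply_iff e).1 hy) ((apply_covBy_apply_iff e).1 hz))
    · exact congrArg e (h2 ((apply_covBy_apply_iff e).1 hy) ((apply_covBy_apply_iff e).1 hz))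

theorem OrderIso.isRed_iff (e : α ≃o β) {a : α} : IsRed (e a) ↔ IsRed a := not_congr e.isIrr_iff

theorem IsIrrStar.isIrr {x : α} (h : IsIrrStar x) : IsIrr x :=
  ⟨fun _ hy _ hz => h.1.unique hy hz, fun _ hy _ hz => h.2.unique hy hz⟩

theorem OrderIso.isIrrStar_iff (e : α ≃o β) {a : α} : IsIrrStar (e a) ↔ IsIrrStar a := by
  unfold IsIrrStar
  rw [e.bijective.existsUnique_iff, e.bijective.existsUnique_iff]
  simp only [apply_covBy_apply_iff]

theorem exists_isChain_covBy [Finite α] {y z : α} (h : y ≤ z) :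
    ∃ l : List α, l.IsChain (· ⋖ ·) ∧ l.head? = some y ∧ l.getLast? = some z := by
  classical
  have := Fintype.ofFinite α
  let _ : LocallyFiniteOrder α := Fintype.toLocallyFiniteOrder
  obtain ⟨l, h1, h2⟩ := List.exists_isChain_cons_of_relationReflTransGen
    (le_iff_reflTransGen_covBy.1 h)
  exact ⟨y :: l, h1, rfl, by rw [List.getLast?_eq_some_getLast (by simp), h2]⟩

theorem List.IsChain.forall_mem_le_getLast {l : List α} (h : l.IsChain (· < ·)) {z : α}
    (hz : l.getLast? = some z) : ∀ w ∈ l, w ≤ z := by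
  induction l with
  | nil => simp
  | cons a l ih =>
    cases l with
    | nil => simp_all
    | cons b l =>
      rw [List.isChain_cons_cons] at h
      rw [List.getLast?_cons_cons] at hz
      have := ih h.2 hz
      intro w hw
      rcases List.mem_cons.1 hw with rfl | hw
      · exact h.1.le.trans (this b (by simp))
      · exact this w hw

/-- An element strictly between `y` and `z` lies on a saturated chain, which is a second path unless
the element is `x`. Conversely, every interior vertex of a path lies strictly between the ends, so a
path has exactly one interior vertex, namely `x`. -/
theorem covBy_path_unique_iff [Finite α] {x y z : α} (hyx : y ⋖ x) (hxz : x ⋖ z) :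
    (∀ l : List α, l.IsChain (· ⋖ ·) → l.head? = some y → l.getLast? = some z → l = [y, x, z]) ↔
      ∀ w, y < w → w < z → w = x := by
  constructor
  · intro h w hyw hwz
    -- The chain is routed through a lower cover `w'` of `z`, so that its last step is known;
    -- uniqueness then forces `w' = x`, and `y ⋖ x` leaves no room for `w` below it.
    obtain ⟨w', hww, hwz'⟩ := exists_le_covBy_of_lt hwz
    obtain ⟨l, hl, hy, hw⟩ := exists_isChain_covBy (hyw.le.trans hww)
    have hyw' := hyw.trans_le hww
    have key := h (l ++ [z]) ?_ ?_ ?_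
    · have : l = [y, x] := by
        have : l ++ [z] = [y, x] ++ [z] := key
        exact List.append_cancel_right this
      subst this
      obtain rfl : x = w' := by simpa using hw
      by_contra hne
      exact hyx.2 hyw (lt_of_le_of_ne hww hne)
    · rw [List.isChain_append]
      refine ⟨hl, by simp, ?_⟩
      intro a ha b hb
      simp only [List.head?_cons, Option.mem_def, Option.some.injEq] at hb
      rw [hw] at ha
      simp only [Option.mem_def, Option.some.injEq] at ha
      subst ha hb
      exact hwz'
    · rw [List.head?_append, hy]; rfl
    · simp
  · intro h l hl hy hz
    have hyz : y < z := hyx.lt.trans hxz.lt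
    match l, hl, hy, hz with
    | [], _, hy, _ => simp at hy
    | [a], _, hy, hz =>
      simp only [List.head?_cons, Option.some.injEq, List.getLast?_singleton] at hy hz
      exact absurd (hy.symm.trans hz) hyz.ne
    | [a, b], hl, hy, hz =>
      simp only [List.head?_cons, Option.some.injEq, List.getLast?_cons_cons,
        List.getLast?_singleton, List.isChain_cons_cons] at hy hz hl
      subst hy hz
      exact absurd hxz.lt (hl.1.2 hyx.lt)
    | [a, b, c], hl, hy, hz =>
      simp only [List.head?_cons, Option.some.injEq, List.getLast?_cons_cons,
        List.getLast?_singleton, List.isChain_cons_cons] at hy hz hl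
      subst hy hz
      rw [h b hl.1.lt hl.2.1.lt]
    | a :: b :: c :: d :: l, hl, hy, hz =>
      exfalso
      simp only [List.head?_cons, Option.some.injEq, List.getLast?_cons_cons,
        List.isChain_cons_cons] at hy hz hl
      subst hy
      have hdz : d ≤ z := List.IsChain.forall_mem_le_getLast
        (hl.2.2.2.imp fun _ _ h => h.lt) hz d (by simp)
      have hcz := hl.2.2.1.lt.trans_le hdz
      have hbz := hl.2.1.lt.trans hcz
      have hb := h b hl.1.lt hbz
      have hc := h c (hl.1.lt.trans hl.2.1.lt) hcz
      exact hl.2.1.lt.ne (hb.trans hc.symm)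

/-- The lower and upper covers of `x` are unique, so the existential over `y` and `z` may be
replaced by a universal one, whose vacuous case is the first alternative of the definition. -/
theorem IsIrrStar.isRetractible_iff [Finite α] {x : α} (hx : IsIrrStar x) :
    IsRetractible x ↔
      ∀ y z, y ⋖ x → x ⋖ z → IsRed y → IsRed z → ∀ w, y < w → w < z → w = x := by
  constructor
  · rintro ⟨hi, h | ⟨y, z, hy, hz, hyx, hxz, h⟩⟩ y' z' hyx' hxz' hy' hz'
    · exact absurd ⟨y', z', hy', hz', hyx', hxz'⟩ h
    · obtain rfl := hi.1 hyx hyx'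
      obtain rfl := hi.2 hxz hxz'
      exact (covBy_path_unique_iff hyx hxz).1 h
  · intro h
    refine ⟨hx.isIrr, ?_⟩
    by_cases hc : ∃ y z : α, IsRed y ∧ IsRed z ∧ y ⋖ x ∧ x ⋖ z
    · obtain ⟨y, z, hy, hz, hyx, hxz⟩ := hc
      exact .inr ⟨y, z, hy, hz, hyx, hxz,
        (covBy_path_unique_iff hyx hxz).2 (h y z hyx hxz hy hz)⟩
    · exact .inl hc

theorem OrderIso.isRetractible_iff [Finite α] (e : α ≃o β) {a : α} (ha : IsIrrStar a) :
    IsRetractible (e a) ↔ IsRetractible a := by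
  have : Finite β := Finite.of_equiv _ e.toEquiv
  rw [ha.isRetractible_iff, (e.isIrrStar_iff.2 ha).isRetractible_iff]
  simp only [e.surjective.forall, apply_covBy_apply_iff, e.isRed_iff, e.lt_iff_lt,
    e.injective.eq_iff]

theorem OrderIso.isBasicRetract_iff [Finite α] (e : α ≃o β) :
    IsBasicRetract β ↔ IsBasicRetract α := by
  unfold IsBasicRetract
  rw [e.surjective.forall]
  refine forall_congr' fun a => ?_
  rw [e.isIrrStar_iff]
  exact forall_congr' fun ha => not_congr (e.isRetractible_iff ha)

theorem not_isPendant_of_ne [Finite α] {x y z : α} (hyz : y ≠ z)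
    (hy : y ∈ (SimpleGraph.hasse α).neighborSet x)
    (hz : z ∈ (SimpleGraph.hasse α).neighborSet x) : ¬ IsPendant x := by
  intro h
  obtain ⟨w, hw⟩ := Set.ncard_eq_one.1 h
  rw [hw] at hy hz
  exact hyz (hy.trans hz.symm)

theorem IsIrrStar.not_isPendant [Finite α] {x : α} (hx : IsIrrStar x) : ¬ IsPendant x := by
  obtain ⟨y, hy, -⟩ := hx.1
  obtain ⟨z, hz, -⟩ := hx.2
  exact not_isPendant_of_ne (hy.lt.trans hz.lt).ne (.inr hy) (.inl hz)

theorem IsRed.not_isPendant [Finite α] {x : α} (hx : IsRed x) : ¬ IsPendant x := by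
  unfold IsRed IsIrr at hx
  rw [not_and_or, Set.not_subsingleton_iff, Set.not_subsingleton_iff] at hx
  rcases hx with ⟨y, hy, z, hz, hne⟩ | ⟨y, hy, z, hz, hne⟩
  · exact not_isPendant_of_ne hne (.inr hy) (.inr hz)
  · exact not_isPendant_of_ne hne (.inl hy) (.inl hz)

/-- By asymmetry of the order every edge carries exactly one orientation. -/
theorem ncard_edgeSet_hasse :
    (SimpleGraph.hasse α).edgeSet.ncard = {p : α × α | p.1 ⋖ p.2}.ncard := by
  have : (SimpleGraph.hasse α).edgeSet = (fun p : α × α => s(p.1, p.2)) '' {p | p.1 ⋖ p.2} := by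
    ext ⟨a, b⟩
    simp only [Set.mem_image, Set.mem_ofPred_eq, Prod.exists]
    change (a ⋖ b ∨ b ⋖ a) ↔ ∃ x y, x ⋖ y ∧ s(x, y) = s(a, b)
    constructor
    · rintro (h | h)
      · exact ⟨a, b, h, rfl⟩
      · exact ⟨b, a, h, Sym2.eq_swap⟩
    · rintro ⟨x, y, h, h'⟩
      rcases Sym2.eq_iff.1 h' with ⟨rfl, rfl⟩ | ⟨rfl, rfl⟩
      exacts [.inl h, .inr h]
  rw [this, Set.InjOn.ncard_image]
  rintro ⟨a, b⟩ hab ⟨c, d⟩ hcd h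
  rcases Sym2.eq_iff.1 h with ⟨h1, h2⟩ | ⟨h1, h2⟩
  · exact Prod.ext h1 h2
  · simp only [Set.mem_ofPred_eq] at h1 h2 hab hcd
    subst h1 h2
    exact absurd hab.lt hcd.lt.asymm

/-- A saturated chain joins the bottom to every element. -/
theorem card_connectedComponent_hasse [Finite α] {b : α} (hb : IsBot b) :
    Nat.card (SimpleGraph.hasse α).ConnectedComponent = 1 := by
  classical
  have := Fintype.ofFinite α
  let _ : LocallyFiniteOrder α := Fintype.toLocallyFiniteOrder
  rw [Nat.card_eq_one_iff_unique]
  have key : ∀ x, (SimpleGraph.hasse α).Reachable b x := fun x => by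
    have := le_iff_reflTransGen_covBy.1 (hb x)
    induction this with
    | refl => exact SimpleGraph.Reachable.refl b
    | tail _ h ih => exact ih.trans (SimpleGraph.Adj.reachable (.inl h))
  refine ⟨⟨fun c d => ?_⟩, ⟨(SimpleGraph.hasse α).connectedComponentMk b⟩⟩
  induction c using SimpleGraph.ConnectedComponent.ind with | h x => ?_
  induction d using SimpleGraph.ConnectedComponent.ind with | h y => ?_
  exact SimpleGraph.ConnectedComponent.sound ((key x).symm.trans (key y))

theorem OrderIso.ncard_covBy (e : α ≃o β) :
    {p : α × α | p.1 ⋖ p.2}.ncard = {p : β × β | p.1 ⋖ p.2}.ncard := by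
  have : {p : β × β | p.1 ⋖ p.2} = (e.toEquiv.prodCongr e.toEquiv) '' {p | p.1 ⋖ p.2} := by
    ext ⟨a, b⟩
    simp only [Set.mem_ofPred_eq, Equiv.image_eq_preimage_symm, Set.mem_preimage]
    exact (apply_covBy_apply_iff e.symm).symm
  rw [this, Set.ncard_image_of_injective _ (Equiv.injective _)]

end FinitePoset

/-! ### Reducibility in a lattice expressed by the order alone -/

section FiniteLattice

variable {α : Type*} [Lattice α]

/-- The order-theoretic form can be transported to finite subsets of `Frame`, where no lattice
operations are given. -/
theorem isJoinReducible_iff_isProperJoin {a : α} : IsJoinReducible a ↔ IsProperJoin a := by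
  constructor
  · rintro ⟨b, c, hb, hc, rfl⟩
    exact ⟨b, c, lt_of_le_of_ne le_sup_left hb, lt_of_le_of_ne le_sup_right hc,
      fun z => sup_le⟩
  · rintro ⟨b, c, hb, hc, h⟩
    exact ⟨b, c, hb.ne, hc.ne, le_antisymm (sup_le hb.le hc.le) (h _ le_sup_left le_sup_right)⟩

theorem isMeetReducible_iff_isProperMeet {a : α} : IsMeetReducible a ↔ IsProperMeet a := by
  constructor
  · rintro ⟨b, c, hb, hc, rfl⟩
    exact ⟨b, c, lt_of_le_of_ne inf_le_left hb.symm, lt_of_le_of_ne inf_le_right hc.symm,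
      fun z => le_inf⟩
  · rintro ⟨b, c, hb, hc, h⟩
    exact ⟨b, c, hb.ne', hc.ne', le_antisymm (h _ inf_le_left inf_le_right) (le_inf hb.le hc.le)⟩

end FiniteLattice

/-! ### The ambient poset of nodes and strands -/

/-- The lower end of the `q`-th pair of nodes; the pairs `0`, `1`, `2` are the consecutive ones. -/
def src : Fin 6 → Fin 4 := ![0, 1, 2, 0, 1, 0]

/-- The upper end of the `q`-th pair of nodes. -/
def tgt : Fin 6 → Fin 4 := ![1, 2, 3, 2, 3, 3]

theorem src_lt_tgt : ∀ q, src q < tgt q := by decide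

theorem pair_ext : ∀ q q', src q = src q' → tgt q = tgt q' → q = q' := by decide

theorem exists_pair : ∀ u v, u < v → ∃ q, src q = u ∧ tgt q = v := by decide

theorem exists_node_between : ∀ q : Fin 6, 3 ≤ q → ∃ v, src q < v ∧ v < tgt q := by decide

theorem not_node_between : ∀ q : Fin 6, ¬ 3 ≤ q → ∀ v, src q < v → tgt q ≤ v := by decide

theorem exists_node_pred : ∀ q : Fin 6, 3 ≤ q → ∃ v, src q < v ∧ v < tgt q ∧
    ∀ w, w < tgt q → w ≤ v := by decide

theorem exists_node_succ : ∀ q : Fin 6, 3 ≤ q → ∃ v, src q < v ∧ v < tgt q ∧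
    ∀ w, src q < w → v ≤ w := by decide

theorem pair_eq_of_tgt_eq : ∀ q q' : Fin 6, ¬ 3 ≤ q → ¬ 3 ≤ q' → tgt q = tgt q' → q = q' := by
  decide

theorem pair_eq_of_src_eq : ∀ q q' : Fin 6, ¬ 3 ≤ q → ¬ 3 ≤ q' → src q = src q' → q = q' := by
  decide

/-- Four nodes forming a chain, and for each pair of nodes infinitely many strands between them;
`link q i p` is the element at position `p` of the `i`-th strand of the `q`-th pair. -/
inductive Frame : Type
  | node (v : Fin 4) : Frame
  | link (q : Fin 6) (i p : ℕ) : Frame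

namespace Frame

instance : DecidableEq Frame
  | node v, node w => decidable_of_iff (v = w) (by simp)
  | link q i p, link q' i' p' => decidable_of_iff (q = q' ∧ i = i' ∧ p = p') (by simp)
  | node _, link _ _ _ => isFalse (by simp)
  | link _ _ _, node _ => isFalse (by simp)

/-- The order in which different strands meet only at the nodes. -/
def le : Frame → Frame → Prop
  | node v, node w => v ≤ w
  | node v, link q _ _ => v ≤ src q
  | link q _ _, node v => tgt q ≤ v
  | link q i p, link q' i' p' => (q = q' ∧ i = i' ∧ p ≤ p') ∨ tgt q ≤ src q'

instance : PartialOrder Frame where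
  le := le
  le_refl x := by cases x <;> simp [le]
  le_trans x y z := by
    have h := src_lt_tgt
    rcases x with u | ⟨q, i, p⟩ <;> rcases y with v | ⟨q', i', p'⟩ <;>
      rcases z with w | ⟨q'', i'', p''⟩ <;> simp only [le] <;> grind
  le_antisymm x y := by
    have h := src_lt_tgt
    rcases x with u | ⟨q, i, p⟩ <;> rcases y with v | ⟨q', i', p'⟩ <;> simp only [le] <;> grind

variable {q q' : Fin 6} {i i' p p' : ℕ} {v w : Fin 4}

@[simp] theorem node_le_node : node v ≤ node w ↔ v ≤ w := Iff.rfl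
@[simp] theorem node_le_link : node v ≤ link q i p ↔ v ≤ src q := Iff.rfl
@[simp] theorem link_le_node : link q i p ≤ node v ↔ tgt q ≤ v := Iff.rfl
theorem link_le_link :
    link q i p ≤ link q' i' p' ↔ (q = q' ∧ i = i' ∧ p ≤ p') ∨ tgt q ≤ src q' := Iff.rfl

@[simp] theorem node_lt_node : node v < node w ↔ v < w := by
  simp only [lt_iff_le_not_ge, node_le_node]

@[simp] theorem node_lt_link : node v < link q i p ↔ v ≤ src q := by
  simp only [lt_iff_le_not_ge, node_le_link, link_le_node, and_iff_left_iff_imp]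
  exact fun h => not_le.2 (h.trans_lt (src_lt_tgt q))

@[simp] theorem link_lt_node : link q i p < node v ↔ tgt q ≤ v := by
  simp only [lt_iff_le_not_ge, node_le_link, link_le_node, and_iff_left_iff_imp]
  exact fun h => not_le.2 ((src_lt_tgt q).trans_le h)

theorem link_lt_link :
    link q i p < link q' i' p' ↔ (q = q' ∧ i = i' ∧ p < p') ∨ tgt q ≤ src q' := by
  have h := src_lt_tgt
  simp only [lt_iff_le_not_ge, link_le_link]
  grind

theorem link_le_link_same : link q i p ≤ link q i' p' ↔ i = i' ∧ p ≤ p' := by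
  have := src_lt_tgt q
  simp only [link_le_link, true_and, or_iff_left_iff_imp]
  omega

instance : DecidableLE Frame := fun x y => by
  cases x <;> cases y <;> simp only [node_le_node, node_le_link, link_le_node, link_le_link] <;>
    infer_instance

/-- The lower end of an element. -/
def lower : Frame → Fin 4
  | node v => v
  | link q _ _ => src q

/-- The upper end of an element. -/
def upper : Frame → Fin 4
  | node v => v
  | link q _ _ => tgt q

theorem node_le_iff {x : Frame} : node v ≤ x ↔ v ≤ x.lower := by cases x <;> rfl

theorem le_node_iff {x : Frame} : x ≤ node v ↔ x.upper ≤ v := by cases x <;> rfl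

/-- The pair of nodes of an element of a strand. -/
def pair : Frame → Option (Fin 6)
  | node _ => none
  | link q _ _ => some q

/-- The index of the strand of an element. -/
def idx : Frame → ℕ
  | node _ => 0
  | link _ i _ => i

/-- The position of an element in its strand. -/
def pos : Frame → ℕ
  | node _ => 0
  | link _ _ p => p

/-- The (nonempty) strands of `X` for the pair `q`. -/
def strands (X : Finset Frame) (q : Fin 6) : Finset ℕ :=
  (X.filter fun x => x.pair = some q).image idx

/-- The positions of the elements of a strand. -/
def strand (X : Finset Frame) (q : Fin 6) (i : ℕ) : Finset ℕ :=
  (X.filter fun x => x.pair = some q ∧ x.idx = i).image pos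

/-- The sizes of the nonempty strands. -/
def sizes (X : Finset Frame) (q : Fin 6) : Multiset ℕ :=
  ∑ i ∈ strands X q, {(strand X q i).card}

/-- The numbers of nonempty strands. -/
def width (X : Finset Frame) (q : Fin 6) : ℕ := (strands X q).card

variable {X : Finset Frame}

theorem mem_strands : i ∈ strands X q ↔ ∃ p, link q i p ∈ X := by
  simp only [strands, Finset.mem_image, Finset.mem_filter]
  constructor
  · rintro ⟨x, ⟨hx, hq⟩, rfl⟩
    cases x with
    | node v => simp [pair] at hq
    | link q' i p =>
      obtain rfl : q' = q := by simpa [pair] using hq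
      exact ⟨p, hx⟩
  · rintro ⟨p, hp⟩
    exact ⟨_, ⟨hp, rfl⟩, rfl⟩

theorem mem_strand : p ∈ strand X q i ↔ link q i p ∈ X := by
  simp only [strand, Finset.mem_image, Finset.mem_filter]
  constructor
  · rintro ⟨x, ⟨hx, hq, hi⟩, rfl⟩
    cases x with
    | node v => simp [pair] at hq
    | link q' i' p =>
      obtain rfl : q' = q := by simpa [pair] using hq
      obtain rfl : i' = i := hi
      exact hx
  · intro hp
    exact ⟨_, ⟨hp, rfl, rfl⟩, rfl⟩

theorem card_sizes : Multiset.card (sizes X q) = width X q := by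
  simp [sizes, width]

theorem sum_sizes : (sizes X q).sum = ∑ i ∈ strands X q, (strand X q i).card := by
  simp [sizes, Multiset.sum_sum]

theorem zero_notMem_sizes : 0 ∉ sizes X q := by
  simp only [sizes, Multiset.mem_sum, Multiset.mem_singleton, not_exists, not_and]
  intro i hi h
  obtain ⟨p, hp⟩ := mem_strands.1 hi
  have := mem_strand.2 hp
  rw [Finset.card_eq_zero.1 h.symm] at this
  simp at this

end Frame

/-- The strands that survive in the basic block: those between non-consecutive nodes and those
which have a parallel strand. -/
def core (n : Fin 6 → ℕ) (q : Fin 6) : ℕ := if 3 ≤ q ∨ 2 ≤ n q then n q else 0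

/-- Every node is an end of a strand that survives in the basic block. -/
def Touched (n : Fin 6 → ℕ) : Prop := ∀ v, ∃ q, (src q = v ∨ tgt q = v) ∧ core n q ≠ 0

instance (n : Fin 6 → ℕ) : Decidable (Touched n) := by unfold Touched; infer_instance

/-! ### Reducible and irreducible elements of a finite set of nodes and strands -/

namespace Frame

/-- `X` contains all nodes and each of them is reducible. -/
structure Reduced (X : Finset Frame) : Prop where
  node_mem (v : Fin 4) : node v ∈ X
  touched : Touched (width X)

variable {q q' : Fin 6} {i i' p p' : ℕ} {v w : Fin 4} {X : Finset Frame}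

theorem node_injective : Function.Injective node := fun _ _ h => by simpa using h

theorem core_width_ne_zero : core (width X) q ≠ 0 ↔
    (3 ≤ q ∧ (strands X q).Nonempty) ∨ ∃ i ∈ strands X q, ∃ j ∈ strands X q, i ≠ j := by
  rw [← Finset.one_lt_card_iff_nontrivial.trans (by rfl :
    (strands X q).Nontrivial ↔ ∃ i ∈ strands X q, ∃ j ∈ strands X q, i ≠ j)]
  rw [← Finset.card_pos]
  unfold core width
  split_ifs <;> grind

/-- A strand of the core ending at `v` makes `v` a proper join. -/
theorem isProperJoin_node (hX : ∀ v, node v ∈ X) (hq : core (width X) q ≠ 0) (hv : tgt q = v) :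
    IsProperJoin (⟨node v, hX v⟩ : X) := by
  subst hv
  rcases core_width_ne_zero.1 hq with ⟨h3, i, hi⟩ | ⟨i, hi, j, hj, hij⟩
  · obtain ⟨p, hp⟩ := mem_strands.1 hi
    -- The other witness is a node inside the pair. An upper bound of both cannot lie on the strand
    -- itself, whose elements are not above that node.
    obtain ⟨v, hv1, hv2, hv⟩ := exists_node_pred q h3
    refine ⟨⟨_, hp⟩, ⟨_, hX v⟩, by simp [← Subtype.coe_lt_coe], by simp [← Subtype.coe_lt_coe, hv2],
      ?_⟩
    rintro ⟨z, hz⟩ h1 h2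
    simp only [Subtype.mk_le_mk] at *
    cases z with
    | node w => simpa using h1
    | link q' i' p' =>
      rw [link_le_link] at h1
      rw [node_le_link] at h2 ⊢
      rcases h1 with ⟨rfl, -⟩ | h
      · exact absurd h2 hv1.not_ge
      · exact h
  · obtain ⟨p, hp⟩ := mem_strands.1 hi
    obtain ⟨p', hp'⟩ := mem_strands.1 hj
    refine ⟨⟨_, hp⟩, ⟨_, hp'⟩, by simp [← Subtype.coe_lt_coe], by simp [← Subtype.coe_lt_coe], ?_⟩
    rintro ⟨z, hz⟩ h1 h2
    simp only [Subtype.mk_le_mk] at *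
    cases z with
    | node w => simpa using h1
    | link q' i' p' =>
      rw [link_le_link] at h1 h2
      rw [node_le_link]
      have := src_lt_tgt q
      grind

/-- A strand of the core starting at `v` makes `v` a proper meet. -/
theorem isProperMeet_node (hX : ∀ v, node v ∈ X) (hq : core (width X) q ≠ 0) (hv : src q = v) :
    IsProperMeet (⟨node v, hX v⟩ : X) := by
  subst hv
  rcases core_width_ne_zero.1 hq with ⟨h3, i, hi⟩ | ⟨i, hi, j, hj, hij⟩
  · obtain ⟨p, hp⟩ := mem_strands.1 hi
    obtain ⟨v, hv1, hv2, hv⟩ := exists_node_succ q h3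
    refine ⟨⟨_, hp⟩, ⟨_, hX v⟩, by simp [← Subtype.coe_lt_coe], by simp [← Subtype.coe_lt_coe, hv1],
      ?_⟩
    rintro ⟨z, hz⟩ h1 h2
    simp only [Subtype.mk_le_mk] at *
    cases z with
    | node w => simpa using h1
    | link q' i' p' =>
      rw [link_le_link] at h1
      rw [link_le_node] at h2 ⊢
      rcases h1 with ⟨rfl, -⟩ | h
      · exact absurd h2 hv2.not_ge
      · exact h
  · obtain ⟨p, hp⟩ := mem_strands.1 hi
    obtain ⟨p', hp'⟩ := mem_strands.1 hj
    refine ⟨⟨_, hp⟩, ⟨_, hp'⟩, by simp [← Subtype.coe_lt_coe], by simp [← Subtype.coe_lt_coe], ?_⟩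
    rintro ⟨z, hz⟩ h1 h2
    simp only [Subtype.mk_le_mk] at *
    cases z with
    | node w => simpa using h1
    | link q' i' p' =>
      rw [link_le_link] at h1 h2
      rw [link_le_node]
      have := src_lt_tgt q
      grind

/-- The two witnesses are incomparable, and the node at the larger of their upper ends bounds both,
so one witness has upper end `v`. If no core strand ends at `v`, that witness lies on the only
strand between `v` and the preceding node. The other witness is then on the same strand or below its
source, and in both cases the two are comparable. -/
theorem exists_core_of_isProperJoin (hX : ∀ v, node v ∈ X)
    (h : IsProperJoin (⟨node v, hX v⟩ : X)) : ∃ q, core (width X) q ≠ 0 ∧ tgt q = v := by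
  obtain ⟨⟨b, hb⟩, ⟨c, hc⟩, hbv, hcv, h⟩ := h
  simp only [Subtype.mk_lt_mk] at hbv hcv
  by_contra! hno
  have key : ∀ x, x ∈ X → x < node v → x.upper = v →
      ∃ q i p, x = link q i p ∧ ¬ 3 ≤ q ∧ tgt q = v ∧ ∀ j ∈ strands X q, j = i := by
    intro x hx hxv hu
    cases x with
    | node w => simp [upper] at hu hxv; omega
    | link q i p =>
      have hc : ¬ core (width X) q ≠ 0 := fun hc => hno q hc hu
      rw [core_width_ne_zero] at hc
      push Not at hc
      have hi := mem_strands.2 ⟨p, hx⟩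
      exact ⟨q, i, p, rfl, fun h3 => by simp [hc.1 h3] at hi, hu,
        fun j hj => hc.2 j hj i hi⟩
  have hb' : b.upper ≤ v := le_node_iff.1 hbv.le
  have hc' : c.upper ≤ v := le_node_iff.1 hcv.le
  -- Minimality of the join forces `v` to be at most the larger of the two upper ends.
  have hmax := h ⟨node (max b.upper c.upper), hX _⟩ (le_node_iff.2 (le_max_left _ _))
    (le_node_iff.2 (le_max_right _ _))
  simp only [Subtype.mk_le_mk, node_le_node] at hmax
  have comp : ¬ b ≤ c ∧ ¬ c ≤ b :=
    ⟨fun hle => (h ⟨c, hc⟩ hle le_rfl).not_gt hcv, fun hle => (h ⟨b, hb⟩ le_rfl hle).not_gt hbv⟩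
  have main : ∀ b c, b ∈ X → c ∈ X → b < node v → c < node v → b.upper = v → ¬ b ≤ c → ¬ c ≤ b →
      False := by
    intro b c hb hc hbv hcv hbu h1 h2
    obtain ⟨q, i, p, rfl, h3, ht, hi⟩ := key b hb hbv hbu
    by_cases hcu : c.upper = v
    · obtain ⟨q', i', p', rfl, h3', ht', hi'⟩ := key c hc hcv hcu
      obtain rfl := pair_eq_of_tgt_eq q q' h3 h3' (ht.trans ht'.symm)
      obtain rfl := hi' i (mem_strands.2 ⟨p, hb⟩)
      rw [link_le_link_same] at h1 h2
      omega
    · have hle : c.upper ≤ src q := by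
        have := le_node_iff.1 hcv.le
        by_contra! hlt
        exact hcu (le_antisymm this (ht ▸ not_node_between q h3 _ hlt))
      exact h2 ((le_node_iff.2 hle).trans (by simp))
  rcases le_total b.upper c.upper with hle | hle
  · rw [max_eq_right hle] at hmax
    exact main c b hc hb hcv hbv (le_antisymm hc' hmax) comp.2 comp.1
  · rw [max_eq_left hle] at hmax
    exact main b c hb hc hbv hcv (le_antisymm hb' hmax) comp.1 comp.2

/-- This is the order dual of `exists_core_of_isProperJoin`. -/
theorem exists_core_of_isProperMeet (hX : ∀ v, node v ∈ X)
    (h : IsProperMeet (⟨node v, hX v⟩ : X)) : ∃ q, core (width X) q ≠ 0 ∧ src q = v := by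
  obtain ⟨⟨b, hb⟩, ⟨c, hc⟩, hbv, hcv, h⟩ := h
  simp only [Subtype.mk_lt_mk] at hbv hcv
  by_contra! hno
  have key : ∀ x, x ∈ X → node v < x → x.lower = v →
      ∃ q i p, x = link q i p ∧ ¬ 3 ≤ q ∧ src q = v ∧ ∀ j ∈ strands X q, j = i := by
    intro x hx hxv hu
    cases x with
    | node w => simp [lower] at hu hxv; omega
    | link q i p =>
      have hc : ¬ core (width X) q ≠ 0 := fun hc => hno q hc hu
      rw [core_width_ne_zero] at hc
      push Not at hc
      have hi := mem_strands.2 ⟨p, hx⟩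
      exact ⟨q, i, p, rfl, fun h3 => by simp [hc.1 h3] at hi, hu,
        fun j hj => hc.2 j hj i hi⟩
  have hb' : v ≤ b.lower := node_le_iff.1 hbv.le
  have hc' : v ≤ c.lower := node_le_iff.1 hcv.le
  have hmin := h ⟨node (min b.lower c.lower), hX _⟩ (node_le_iff.2 (min_le_left _ _))
    (node_le_iff.2 (min_le_right _ _))
  simp only [Subtype.mk_le_mk, node_le_node] at hmin
  have comp : ¬ b ≤ c ∧ ¬ c ≤ b :=
    ⟨fun hle => (h ⟨b, hb⟩ le_rfl hle).not_gt hbv, fun hle => (h ⟨c, hc⟩ hle le_rfl).not_gt hcv⟩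
  have main : ∀ b c, b ∈ X → c ∈ X → node v < b → node v < c → b.lower = v → ¬ b ≤ c → ¬ c ≤ b →
      False := by
    intro b c hb hc hbv hcv hbu h1 h2
    obtain ⟨q, i, p, rfl, h3, ht, hi⟩ := key b hb hbv hbu
    by_cases hcu : c.lower = v
    · obtain ⟨q', i', p', rfl, h3', ht', hi'⟩ := key c hc hcv hcu
      obtain rfl := pair_eq_of_src_eq q q' h3 h3' (ht.trans ht'.symm)
      obtain rfl := hi' i (mem_strands.2 ⟨p, hb⟩)
      rw [link_le_link_same] at h1 h2
      omega
    · have hle : tgt q ≤ c.lower := by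
        have := node_le_iff.1 hcv.le
        exact not_node_between q h3 _ (lt_of_le_of_ne (ht ▸ this) (fun h => hcu (h ▸ ht)))
      exact h1 ((show link q i p ≤ node (tgt q) by simp).trans (node_le_iff.2 hle))
  rcases le_total b.lower c.lower with hle | hle
  · rw [min_eq_left hle] at hmin
    exact main b c hb hc hbv hcv (le_antisymm hmin hb') comp.1 comp.2
  · rw [min_eq_right hle] at hmin
    exact main c b hc hb hcv hbv (le_antisymm hmin hc') comp.2 comp.1

/-- Below an element of a strand there is first the rest of its strand, a chain, and then only what
lies below the source node. This and its dual give the unique covers of strand elements, their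
irreducibility, and the lattice property of such sets. -/
theorem le_or_le_or_of_lt_link {x y : Frame} (hx : x < link q i p) (hy : y < link q i p) :
    (x ≤ y ∨ y ≤ x) ∨ (x ≤ node (src q) ∧ y ≤ node (src q)) := by
  have h := src_lt_tgt
  cases x <;> cases y <;>
    simp only [node_lt_link, link_lt_link, node_le_node, node_le_link, link_le_node,
      link_le_link] at * <;> grind

theorem le_or_le_or_of_link_lt {x y : Frame} (hx : link q i p < x) (hy : link q i p < y) :
    (x ≤ y ∨ y ≤ x) ∨ (node (tgt q) ≤ x ∧ node (tgt q) ≤ y) := by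
  have h := src_lt_tgt
  cases x <;> cases y <;>
    simp only [link_lt_node, link_lt_link, node_le_node, node_le_link, link_le_node,
      link_le_link] at * <;> grind

theorem not_isProperJoin_link (hX : ∀ v, node v ∈ X) (h : link q i p ∈ X) :
    ¬ IsProperJoin (⟨_, h⟩ : X) := by
  rintro ⟨b, c, hb, hc, hz⟩
  rcases le_or_le_or_of_lt_link hb hc with (h' | h') | ⟨h1, h2⟩
  · exact (hz c h' le_rfl).not_gt hc
  · exact (hz b le_rfl h').not_gt hb
  · have := hz ⟨_, hX _⟩ h1 h2
    simp only [Subtype.mk_le_mk, link_le_node] at this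
    exact this.not_gt (src_lt_tgt q)

theorem not_isProperMeet_link (hX : ∀ v, node v ∈ X) (h : link q i p ∈ X) :
    ¬ IsProperMeet (⟨_, h⟩ : X) := by
  rintro ⟨b, c, hb, hc, hz⟩
  rcases le_or_le_or_of_link_lt hb hc with (h' | h') | ⟨h1, h2⟩
  · exact (hz b le_rfl h').not_gt hb
  · exact (hz c h' le_rfl).not_gt hc
  · have := hz ⟨_, hX _⟩ h1 h2
    simp only [Subtype.mk_le_mk, node_le_link] at this
    exact this.not_gt (src_lt_tgt q)

/-- The end nodes of the strand belong to `X`, so covers exist on both sides. Two covers on one side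
would be incomparable, hence both beyond the end node, hence both equal to it. -/
theorem isIrrStar_link (hX : ∀ v, node v ∈ X) (h : link q i p ∈ X) :
    IsIrrStar (⟨_, h⟩ : X) := by
  constructor
  · have hlt : (⟨node (src q), hX _⟩ : X) < ⟨_, h⟩ := by simp [← Subtype.coe_lt_coe]
    obtain ⟨y, -, hy⟩ := exists_le_covBy_of_lt hlt
    refine ⟨y, hy, fun z hz => ?_⟩
    rcases le_or_le_or_of_lt_link hz.lt hy.lt with (h' | h') | ⟨h1, h2⟩
    · by_contra hne
      exact hz.2 (lt_of_le_of_ne h' hne) hy.lt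
    · by_contra hne
      exact hy.2 (lt_of_le_of_ne h' (Ne.symm hne)) hz.lt
    · have key : ∀ y : X, y ⋖ ⟨_, h⟩ → y.1 ≤ node (src q) → y = ⟨_, hX (src q)⟩ := by
        intro y hy h2
        by_contra hne
        exact hy.2 (lt_of_le_of_ne h2 hne) hlt
      rw [key z hz h1, key y hy h2]
  · have hlt : (⟨_, h⟩ : X) < ⟨node (tgt q), hX _⟩ := by simp [← Subtype.coe_lt_coe]
    obtain ⟨y, hy, -⟩ := exists_covBy_le_of_lt hlt
    refine ⟨y, hy, fun z hz => ?_⟩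
    rcases le_or_le_or_of_link_lt hz.lt hy.lt with (h' | h') | ⟨h1, h2⟩
    · by_contra hne
      exact hy.2 hz.lt (lt_of_le_of_ne h' hne)
    · by_contra hne
      exact hz.2 hy.lt (lt_of_le_of_ne h' (Ne.symm hne))
    · have key : ∀ y : X, (⟨_, h⟩ : X) ⋖ y → node (tgt q) ≤ y.1 → y = ⟨_, hX (tgt q)⟩ := by
        intro y hy h2
        by_contra hne
        exact hy.2 hlt (lt_of_le_of_ne h2 (Ne.symm hne))
      rw [key z hz h1, key y hy h2]

theorem Reduced.isProperJoin_or_isProperMeet (hX : Reduced X) (v : Fin 4) :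
    IsProperJoin (⟨node v, hX.node_mem v⟩ : X) ∨ IsProperMeet (⟨node v, hX.node_mem v⟩ : X) := by
  obtain ⟨q, hq | hq, hc⟩ := hX.touched v
  · exact .inr (isProperMeet_node hX.node_mem hc hq)
  · exact .inl (isProperJoin_node hX.node_mem hc hq)

/-- The set of nodes is thus recovered from the abstract order, so every isomorphism preserves it.
-/
theorem Reduced.isRed_iff (hX : Reduced X) (x : X) : IsRed x ↔ ∃ v, x.1 = node v := by
  obtain ⟨x, hx⟩ := x
  cases x with
  | node v =>
    simp only [node.injEq, exists_eq', iff_true]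
    rcases hX.isProperJoin_or_isProperMeet v with h | h
    exacts [h.isRed, h.isRed]
  | link q i p => simpa [IsRed] using (isIrrStar_link hX.node_mem hx).isIrr

theorem Reduced.isProper_iff (hX : Reduced X) (x : X) :
    (IsProperMeet x ∨ IsProperJoin x) ↔ ∃ v, x.1 = node v := by
  obtain ⟨x, hx⟩ := x
  cases x with
  | node v => simpa using (hX.isProperJoin_or_isProperMeet v).symm
  | link q i p =>
    simpa using ⟨not_isProperMeet_link hX.node_mem hx, not_isProperJoin_link hX.node_mem hx⟩

end Frame

/-! ### The sizes of the strands determine the poset up to isomorphism -/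

/-- Equal multisets of values come from a value-preserving matching of the index sets. It serves to
pair the strands of two posets by size; the induction removes one matched pair of indices at a time.
-/
theorem exists_injOn_of_sum_singleton_eq {ι κ γ : Type*} [DecidableEq ι] [DecidableEq κ]
    [Nonempty κ] (g : ι → γ) (g' : κ → γ) (s : Finset ι) :
    ∀ t : Finset κ, ∑ i ∈ s, ({g i} : Multiset γ) = ∑ i ∈ t, {g' i} →
      ∃ σ : ι → κ, Set.InjOn σ s ∧ s.image σ = t ∧ ∀ i ∈ s, g' (σ i) = g i := by
  induction s using Finset.induction_on with
  | empty =>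
    intro t h
    have : t = ∅ := by
      by_contra hne
      obtain ⟨b, hb⟩ := Finset.nonempty_iff_ne_empty.2 hne
      have : g' b ∈ (0 : Multiset γ) := by
        rw [Finset.sum_empty] at h
        rw [h, Multiset.mem_sum]
        exact ⟨b, hb, by simp⟩
      simp at this
    subst this
    exact ⟨fun _ => Classical.arbitrary κ, by simp, by simp, by simp⟩
  | insert a s ha ih =>
    intro t h
    rw [Finset.sum_insert ha] at h
    have : g a ∈ ∑ i ∈ t, ({g' i} : Multiset γ) := by rw [← h]; simp
    obtain ⟨b, hb, hab⟩ := Multiset.mem_sum.1 this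
    rw [Multiset.mem_singleton] at hab
    rw [← Finset.add_sum_erase t _ hb, hab] at h
    obtain ⟨σ, h1, h2, h3⟩ := ih (t.erase b) (add_left_cancel h)
    have hσ : ∀ i ∈ s, Function.update σ a b i = σ i := fun i hi =>
      Function.update_of_ne (ne_of_mem_of_not_mem hi ha) _ _
    have hne : ∀ i ∈ s, σ i ≠ b := fun i hi h => by
      have : σ i ∈ t.erase b := h2 ▸ Finset.mem_image_of_mem _ hi
      simp [h] at this
    refine ⟨Function.update σ a b, ?_, ?_, ?_⟩
    · intro i hi j hj hij
      rcases Finset.mem_insert.1 hi with rfl | hi' <;> rcases Finset.mem_insert.1 hj with rfl | hj'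
      · rfl
      · rw [hσ _ hj', Function.update_self] at hij
        exact absurd hij.symm (hne j hj')
      · rw [hσ _ hi', Function.update_self] at hij
        exact absurd hij (hne i hi')
      · rw [hσ _ hj', hσ _ hi'] at hij
        exact h1 hi' hj' hij
    · rw [Finset.image_insert, Function.update_self, Finset.image_congr (g := σ), h2,
        Finset.insert_erase hb]
      exact fun i hi => hσ i hi
    · intro i hi
      rcases Finset.mem_insert.1 hi with rfl | hi
      · rw [Function.update_self, hab]
      · rw [hσ i hi, h3 i hi]

theorem exists_strictMonoOn_of_card_eq (s t : Finset ℕ) (h : s.card = t.card) :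
    ∃ π : ℕ → ℕ, StrictMonoOn π s ∧ s.image π = t := by
  have hm : StrictMonoOn (fun p => if h' : p ∈ s then
      (t.orderIsoOfFin h.symm ((s.orderIsoOfFin rfl).symm ⟨p, h'⟩) : ℕ) else 0) s := by
    intro p hp p' hp' hlt
    rw [Finset.mem_coe] at hp hp'
    simpa [hp, hp'] using hlt
  refine ⟨_, hm, Finset.eq_of_subset_of_card_le ?_ ?_⟩
  · intro x hx
    obtain ⟨p, hp, rfl⟩ := Finset.mem_image.1 hx
    simp only [hp, dite_true]
    exact Subtype.property _
  · rw [Finset.card_image_of_injOn hm.injOn, h]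

namespace Frame

variable {X Y : Finset Frame}

/-- Strands of equal size are matched within each pair, and their positions are matched
increasingly. Comparisons that are not within one strand depend only on the nodes and pairs
involved, which stay fixed. -/
theorem nonempty_orderIso_of_sizes_eq (hX : ∀ v, node v ∈ X) (hY : ∀ v, node v ∈ Y)
    (h : sizes X = sizes Y) : Nonempty (X ≃o Y) := by
  have h1 : ∀ q, ∃ σ : ℕ → ℕ, Set.InjOn σ (strands X q) ∧ (strands X q).image σ = strands Y q ∧
      ∀ i ∈ strands X q, (strand Y q (σ i)).card = (strand X q i).card := fun q =>
    exists_injOn_of_sum_singleton_eq _ _ _ _ (congrFun h q)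
  choose σ hσ1 hσ2 hσ3 using h1
  have h2 : ∀ q i, ∃ π : ℕ → ℕ, i ∈ strands X q → StrictMonoOn π (strand X q i) ∧
      (strand X q i).image π = strand Y q (σ q i) := by
    intro q i
    by_cases hi : i ∈ strands X q
    · obtain ⟨π, hπ⟩ := exists_strictMonoOn_of_card_eq (strand X q i) _ (hσ3 q i hi).symm
      exact ⟨π, fun _ => hπ⟩
    · exact ⟨id, fun h => absurd h hi⟩
  choose π hπ using h2
  let f : Frame → Frame
    | node v => node v
    | link q i p => link q (σ q i) (π q i p)
  have hf : ∀ x ∈ X, f x ∈ Y := by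
    rintro (v | ⟨q, i, p⟩) hx
    · exact hY v
    · have hi := mem_strands.2 ⟨p, hx⟩
      rw [← mem_strand, ← (hπ q i hi).2]
      exact Finset.mem_image_of_mem _ (mem_strand.2 hx)
  have hle : ∀ x ∈ X, ∀ y ∈ X, f x ≤ f y ↔ x ≤ y := by
    rintro (v | ⟨q, i, p⟩) hx (w | ⟨q', i', p'⟩) hy
    · rfl
    · rfl
    · rfl
    · have hi := mem_strands.2 ⟨p, hx⟩
      have hi' := mem_strands.2 ⟨p', hy⟩
      simp only [f, link_le_link]
      refine or_congr_left ⟨?_, ?_⟩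
      · rintro ⟨rfl, h1, h2⟩
        obtain rfl := hσ1 q hi hi' h1
        exact ⟨rfl, rfl, ((hπ q i hi).1.le_iff_le (mem_strand.2 hx) (mem_strand.2 hy)).1 h2⟩
      · rintro ⟨rfl, rfl, h2⟩
        exact ⟨rfl, rfl, ((hπ q i hi).1.le_iff_le (mem_strand.2 hx) (mem_strand.2 hy)).2 h2⟩
  let F : X ↪o Y := OrderEmbedding.ofMapLEIff (fun x => ⟨f x, hf x x.2⟩)
    fun x y => hle x x.2 y y.2
  refine ⟨RelIso.ofSurjective F ?_⟩
  rintro ⟨y, hy⟩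
  cases y with
  | node v => exact ⟨⟨node v, hX v⟩, rfl⟩
  | link q j p =>
    have hj := mem_strands.2 ⟨p, hy⟩
    rw [← hσ2, Finset.mem_image] at hj
    obtain ⟨i, hi, rfl⟩ := hj
    rw [← mem_strand, ← (hπ q i hi).2, Finset.mem_image] at hy
    obtain ⟨p', hp', rfl⟩ := hy
    exact ⟨⟨link q i p', mem_strand.1 hp'⟩, rfl⟩

/-- Nodes are exactly the reducible elements, and a chain of four elements has no nontrivial
automorphism. -/
theorem Reduced.orderIso_node (hX : Reduced X) (hY : Reduced Y) (e : X ≃o Y) (v : Fin 4) :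
    (e ⟨node v, hX.node_mem v⟩ : Frame) = node v := by
  have h : ∀ v, ∃ w, (e ⟨node v, hX.node_mem v⟩ : Frame) = node w := fun v =>
    (hY.isRed_iff _).1 (e.isRed_iff.2 ((hX.isRed_iff _).2 ⟨v, rfl⟩))
  choose φ hφ using h
  have hlt : ∀ u v, u < v → φ u < φ v := fun u v huv => by
    rw [← node_lt_node, ← hφ, ← hφ, Subtype.coe_lt_coe, e.lt_iff_lt]
    simpa [← Subtype.coe_lt_coe] using huv
  have h01 := hlt 0 1 (by decide)
  have h12 := hlt 1 2 (by decide)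
  have h23 := hlt 2 3 (by decide)
  rw [hφ]
  congr 1
  have : v = 0 ∨ v = 1 ∨ v = 2 ∨ v = 3 := by omega
  rcases this with rfl | rfl | rfl | rfl <;> omega

/-- The pair of a strand element is determined by the nodes below it and above it, and the
isomorphism fixes the nodes. -/
theorem Reduced.orderIso_link (hX : Reduced X) (hY : Reduced Y) (e : X ≃o Y) {q : Fin 6} {i p : ℕ}
    (h : link q i p ∈ X) : ∃ i' p', (e ⟨_, h⟩ : Frame) = link q i' p' := by
  have hn : ¬ ∃ v, (e ⟨_, h⟩ : Frame) = node v := by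
    rw [← hY.isRed_iff, e.isRed_iff, hX.isRed_iff]
    simp
  cases he : (e ⟨_, h⟩ : Frame) with
  | node v => exact absurd ⟨v, he⟩ hn
  | link q' i' p' =>
    refine ⟨i', p', ?_⟩
    have hs : ∀ v, v ≤ src q' ↔ v ≤ src q := fun v => by
      rw [← node_le_link (i := i') (p := p'), ← he, ← hX.orderIso_node hY e v, Subtype.coe_le_coe,
        e.le_iff_le]
      rfl
    have ht : ∀ v, tgt q' ≤ v ↔ tgt q ≤ v := fun v => by
      rw [← link_le_node (i := i') (p := p'), ← he, ← hX.orderIso_node hY e v, Subtype.coe_le_coe,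
        e.le_iff_le]
      rfl
    rw [pair_ext q' q (le_antisymm ((hs _).1 le_rfl) ((hs _).2 le_rfl))
      (le_antisymm ((ht _).2 le_rfl) ((ht _).1 le_rfl))]

/-- Within one pair, two elements are comparable exactly if they are on the same strand. So strands
are comparability classes, and an isomorphism carries them bijectively to strands of the same size.
-/
theorem Reduced.sizes_eq_of_orderIso (hX : Reduced X) (hY : Reduced Y) (e : X ≃o Y) :
    sizes X = sizes Y := by
  funext q
  have h : ∀ i p, ∃ i' p', ∀ h : link q i p ∈ X, (e ⟨_, h⟩ : Frame) = link q i' p' := by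
    intro i p
    by_cases h : link q i p ∈ X
    · obtain ⟨i', p', he⟩ := hX.orderIso_link hY e h
      exact ⟨i', p', fun _ => he⟩
    · exact ⟨0, 0, fun h' => absurd h' h⟩
  choose I P he using h
  have hmem : ∀ {i p}, link q i p ∈ X → link q (I i p) (P i p) ∈ Y := fun h => by
    rw [← he _ _ h]; exact Subtype.property _
  have hle : ∀ {i p i' p'}, link q i p ∈ X → link q i' p' ∈ X →
      ((I i p = I i' p' ∧ P i p ≤ P i' p') ↔ (i = i' ∧ p ≤ p')) := fun h h' => by
    rw [← link_le_link_same (q := q), ← link_le_link_same (q := q), ← he _ _ h, ← he _ _ h',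
      Subtype.coe_le_coe, e.le_iff_le]
    rfl
  have hI : ∀ {i p i' p'}, link q i p ∈ X → link q i' p' ∈ X → (I i p = I i' p' ↔ i = i') :=
    fun h h' => by
      have := hle h h'
      have := hle h' h
      omega
  have hsurj : ∀ {i' p'}, link q i' p' ∈ Y → ∃ i p, link q i p ∈ X ∧ I i p = i' ∧ P i p = p' := by
    intro i' p' h
    obtain ⟨i, p, hip⟩ := hY.orderIso_link hX e.symm h
    have hX' : link q i p ∈ X := by rw [← hip]; exact Subtype.property _
    refine ⟨i, p, hX', ?_⟩
    have h2 := he _ _ hX'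
    have : (⟨_, hX'⟩ : X) = e.symm ⟨_, h⟩ := Subtype.ext hip.symm
    rw [this, e.apply_symm_apply] at h2
    simpa [eq_comm] using h2
  have hch : ∀ i, ∃ p, i ∈ strands X q → link q i p ∈ X := fun i => by
    by_cases hi : i ∈ strands X q
    · obtain ⟨p, hp⟩ := mem_strands.1 hi
      exact ⟨p, fun _ => hp⟩
    · exact ⟨0, fun h => absurd h hi⟩
  choose c hc using hch
  refine Finset.sum_bij (fun i _ => I i (c i)) ?_ ?_ ?_ ?_
  · exact fun i hi => mem_strands.2 ⟨_, hmem (hc i hi)⟩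
  · exact fun i hi j hj hij => (hI (hc i hi) (hc j hj)).1 hij
  · intro j hj
    obtain ⟨p, hp⟩ := mem_strands.1 hj
    obtain ⟨i, p, h, rfl, rfl⟩ := hsurj hp
    have hi := mem_strands.2 ⟨p, h⟩
    exact ⟨i, hi, (hI (hc i hi) h).2 rfl⟩
  · intro i hi
    congr 1
    refine Finset.card_bij (fun p _ => P i p) ?_ ?_ ?_
    · intro p hp
      rw [mem_strand] at hp ⊢
      rw [(hI (hc i hi) hp).2 rfl]
      exact hmem hp
    · intro p hp p' hp' h
      rw [mem_strand] at hp hp'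
      have := hle hp hp'
      have := hle hp' hp
      have := (hI hp hp').2 rfl
      omega
    · intro p' hp'
      rw [mem_strand] at hp'
      obtain ⟨i', p, h, h1, rfl⟩ := hsurj hp'
      obtain rfl := (hI h (hc i hi)).1 h1
      exact ⟨p, mem_strand.2 h, rfl⟩

end Frame

/-! ### Retracting to the basic block -/

theorem pair_eq_of_between : ∀ q q' : Fin 6, ¬ 3 ≤ q → src q ≤ src q' → tgt q' ≤ tgt q → q' = q := by
  decide

namespace Frame

variable {X : Finset Frame} {q : Fin 6} {i p : ℕ}

/-- Both covers of a strand element are nodes exactly if its strand is a singleton; otherwise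
retractibility is vacuous. For a singleton strand, a second path between the ends exists exactly if
there is a parallel strand or a node inside the pair, which is what `core ≠ 0` records. -/
theorem Reduced.isRetractible_link_iff (hX : Reduced X) (h : link q i p ∈ X) :
    IsRetractible (⟨_, h⟩ : X) ↔ core (width X) q = 0 ∨ 2 ≤ (strand X q i).card := by
  have hlow : (⟨node (src q), hX.node_mem _⟩ : X) < ⟨_, h⟩ := by simp [← Subtype.coe_lt_coe]
  have hupp : (⟨_, h⟩ : X) < ⟨node (tgt q), hX.node_mem _⟩ := by simp [← Subtype.coe_lt_coe]
  have hi := mem_strands.2 ⟨p, h⟩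
  rw [(isIrrStar_link hX.node_mem h).isRetractible_iff]
  constructor
  · intro hr
    by_contra! hc
    obtain ⟨hc, hcard⟩ := hc
    have hone : ∀ p', link q i p' ∈ X → p' = p := fun p' hp' =>
      Finset.card_le_one.1 (by omega) p' (mem_strand.2 hp') p (mem_strand.2 h)
    have h1 : (⟨node (src q), hX.node_mem _⟩ : X) ⋖ ⟨_, h⟩ := by
      refine ⟨hlow, ?_⟩
      rintro ⟨w | ⟨q', i', p'⟩, hw⟩ h1 h2 <;> simp only [Subtype.mk_lt_mk] at h1 h2
      · simp only [node_lt_node, node_lt_link] at h1 h2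
        exact h2.not_gt h1
      · have := src_lt_tgt q'
        rw [node_lt_link] at h1
        rw [link_lt_link] at h2
        rcases h2 with ⟨rfl, rfl, h2⟩ | h2
        · exact h2.ne (hone p' hw)
        · omega
    have h2 : (⟨_, h⟩ : X) ⋖ ⟨node (tgt q), hX.node_mem _⟩ := by
      refine ⟨hupp, ?_⟩
      rintro ⟨w | ⟨q', i', p'⟩, hw⟩ h1 h2 <;> simp only [Subtype.mk_lt_mk] at h1 h2
      · simp only [node_lt_node, link_lt_node] at h1 h2
        exact h1.not_gt h2
      · have := src_lt_tgt q'
        rw [link_lt_node] at h2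
        rw [link_lt_link] at h1
        rcases h1 with ⟨rfl, rfl, h1⟩ | h1
        · exact h1.ne' (hone p' hw)
        · omega
    have hr := hr _ _ h1 h2 ((hX.isRed_iff _).2 ⟨_, rfl⟩) ((hX.isRed_iff _).2 ⟨_, rfl⟩)
    rcases core_width_ne_zero.1 hc with ⟨h3, -⟩ | ⟨j, hj, k, hk, hjk⟩
    · obtain ⟨v, hv1, hv2⟩ := exists_node_between q h3
      have := hr ⟨node v, hX.node_mem v⟩ (by simpa [← Subtype.coe_lt_coe] using hv1)
        (by simpa [← Subtype.coe_lt_coe] using hv2)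
      simp at this
    · obtain ⟨j, hj, hne⟩ : ∃ j ∈ strands X q, j ≠ i := by
        by_cases hji : j = i
        · exact ⟨k, hk, fun h => hjk (hji.trans h.symm)⟩
        · exact ⟨j, hj, hji⟩
      obtain ⟨p', hp'⟩ := mem_strands.1 hj
      have := hr ⟨_, hp'⟩ (by simp [← Subtype.coe_lt_coe]) (by simp [← Subtype.coe_lt_coe])
      simp only [Subtype.mk.injEq, link.injEq] at this
      exact hne this.2.1
  · rintro hc ⟨y, hy⟩ ⟨z, hz⟩ hyx hxz hry hrz ⟨w, hw⟩ hyw hwz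
    obtain ⟨v, rfl⟩ : ∃ v, y = node v := (hX.isRed_iff _).1 hry
    obtain ⟨u, rfl⟩ : ∃ u, z = node u := (hX.isRed_iff _).1 hrz
    have hv : v = src q := by
      have h1 : v ≤ src q := node_lt_link.1 hyx.lt
      by_contra hne
      exact hyx.2 (show (_ : X) < _ from node_lt_node.2 (lt_of_le_of_ne h1 hne)) hlow
    have hu : u = tgt q := by
      have h1 : tgt q ≤ u := link_lt_node.1 hxz.lt
      by_contra hne
      exact hxz.2 hupp (show (_ : X) < _ from node_lt_node.2 (lt_of_le_of_ne h1 (Ne.symm hne)))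
    subst hv hu
    have hone : ∀ p', link q i p' ∈ X → p' = p := by
      intro p' hp'
      rcases lt_trichotomy p' p with hlt | rfl | hlt
      · exact absurd (show (⟨_, hp'⟩ : X) < ⟨_, h⟩ from link_lt_link.2 (.inl ⟨rfl, rfl, hlt⟩))
          (hyx.2 (by simp [← Subtype.coe_lt_coe]))
      · rfl
      · exact absurd (show (⟨_, hp'⟩ : X) < ⟨node (tgt q), hz⟩ by simp [← Subtype.coe_lt_coe])
          (hxz.2 (show (⟨_, h⟩ : X) < ⟨_, hp'⟩ from link_lt_link.2 (.inl ⟨rfl, rfl, hlt⟩)))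
    rcases hc with hc | hc
    · have hc' : ¬ core (width X) q ≠ 0 := by simpa using hc
      rw [core_width_ne_zero] at hc'
      push Not at hc'
      have h3 : ¬ 3 ≤ q := fun h3 => by simp [hc'.1 h3] at hi
      rw [Subtype.mk_lt_mk] at hyw hwz
      cases w with
      | node w =>
        exact absurd (node_lt_node.1 hwz) (not_node_between q h3 w (node_lt_node.1 hyw)).not_gt
      | link q' i' p' =>
        obtain rfl := pair_eq_of_between q q' h3 (node_lt_link.1 hyw) (link_lt_node.1 hwz)
        obtain rfl := hc'.2 i' (mem_strands.2 ⟨_, hw⟩) i hi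
        rw [Subtype.mk.injEq, hone p' hw]
    · obtain ⟨a, ha, b, hb, hab⟩ := Finset.one_lt_card.1 hc
      exact absurd ((hone a (mem_strand.1 ha)).trans (hone b (mem_strand.1 hb)).symm) hab

theorem strands_erase_of_ne {q' : Fin 6} (hq : q' ≠ q) :
    strands (X.erase (link q i p)) q' = strands X q' := by
  ext j
  simp [mem_strands, hq]

theorem strands_erase_subset {x : Frame} : strands (X.erase x) q ⊆ strands X q := by
  intro j
  simp only [mem_strands, Finset.mem_erase]
  exact fun ⟨p, _, hp⟩ => ⟨p, hp⟩

theorem strands_erase_of_two_le (hc : 2 ≤ (strand X q i).card) :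
    strands (X.erase (link q i p)) q = strands X q := by
  refine strands_erase_subset.antisymm fun j hj => ?_
  obtain ⟨p', hp'⟩ := mem_strands.1 hj
  by_cases hji : j = i
  · subst hji
    obtain ⟨a, ha, hap⟩ := Finset.exists_mem_ne hc p
    exact mem_strands.2 ⟨a, Finset.mem_erase.2 ⟨by simp [hap], mem_strand.1 ha⟩⟩
  · exact mem_strands.2 ⟨p', Finset.mem_erase.2 ⟨by simp [hji], hp'⟩⟩

/-- Removing an element from a strand with at least two elements keeps the strand. If the core is 0,
the width of the pair can only drop, and the core remains 0. -/
theorem core_width_erase (hc : core (width X) q = 0 ∨ 2 ≤ (strand X q i).card) :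
    core (width (X.erase (link q i p))) = core (width X) := by
  funext q'
  by_cases hq : q' = q
  · subst hq
    rcases hc with hc | hc
    · have : width (X.erase (link q' i p)) q' ≤ width X q' :=
        Finset.card_le_card strands_erase_subset
      rw [hc]
      unfold core at *
      split_ifs at * <;> omega
    · unfold core width
      rw [strands_erase_of_two_le hc]
  · unfold core width
    rw [strands_erase_of_ne hq]

theorem Reduced.erase (hX : Reduced X) (hc : core (width X) q = 0 ∨ 2 ≤ (strand X q i).card) :
    Reduced (X.erase (link q i p)) where
  node_mem v := Finset.mem_erase.2 ⟨by simp, hX.node_mem v⟩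
  touched v := by
    rw [core_width_erase hc]
    exact hX.touched v

/-- When nothing is retractible, every strand present is a singleton and belongs to a pair with
nonzero core, so width and core agree. -/
theorem Reduced.sizes_of_isBasicRetract (hX : Reduced X) (hb : IsBasicRetract X) (q : Fin 6) :
    sizes X q = Multiset.replicate (core (width X) q) 1 := by
  have key : ∀ i ∈ strands X q, core (width X) q ≠ 0 ∧ (strand X q i).card = 1 := by
    intro i hi
    obtain ⟨p, hp⟩ := mem_strands.1 hi
    have := hb _ (isIrrStar_link hX.node_mem hp)
    rw [hX.isRetractible_link_iff hp] at this
    have h0 : 0 < (strand X q i).card := Finset.card_pos.2 ⟨p, mem_strand.2 hp⟩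
    exact ⟨fun h => this (.inl h), by_contra fun h => this (.inr (by omega))⟩
  have hw : core (width X) q = width X q := by
    by_cases h : (strands X q).Nonempty
    · obtain ⟨i, hi⟩ := h
      have := (key i hi).1
      unfold core at *
      split_ifs at * <;> simp_all
    · rw [Finset.not_nonempty_iff_eq_empty] at h
      simp [core, width, h]
  rw [hw, sizes, Finset.sum_congr rfl fun i hi => by rw [(key i hi).2]]
  simp [width, Multiset.nsmul_singleton]

end Frame

/-! ### Retraction sequences of a poset embedded in the frame -/

section Embedded

open Frame

variable {α : Type*} [PartialOrder α] [Finite α] (f : α ↪o Frame)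

/-- The image of a subset as a finite set. -/
noncomputable def imageFinset (S : Set α) : Finset Frame := S.toFinite.toFinset.map f.toEmbedding

variable {f} in
theorem mem_imageFinset {S : Set α} {x : Frame} : x ∈ imageFinset f S ↔ ∃ a ∈ S, f a = x := by
  simp [imageFinset]

/-- A subset is isomorphic to its image. -/
noncomputable def imageIso (S : Set α) : S ≃o imageFinset f S :=
  RelIso.ofSurjective
    (OrderEmbedding.ofMapLEIff (fun x : S => (⟨f x, mem_imageFinset.2 ⟨x, x.2, rfl⟩⟩ :
      imageFinset f S)) fun _ _ => f.le_iff_le)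
    (by
      rintro ⟨y, hy⟩
      obtain ⟨a, ha, rfl⟩ := mem_imageFinset.1 hy
      exact ⟨⟨a, ha⟩, rfl⟩)

theorem imageFinset_diff_singleton (S : Set α) (a : α) :
    imageFinset f (S \ {a}) = (imageFinset f S).erase (f a) := by
  classical
  ext x
  simp only [mem_imageFinset, Finset.mem_erase, Set.mem_sdiff, Set.mem_singleton_iff]
  constructor
  · rintro ⟨b, ⟨hb, hba⟩, rfl⟩
    exact ⟨fun h => hba (f.injective h), b, hb, rfl⟩
  · rintro ⟨hx, b, hb, rfl⟩
    exact ⟨b, ⟨hb, fun h => hx (h ▸ rfl)⟩, rfl⟩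

variable {f}

theorem RetractStep.reduced {S T : Set α} (h : RetractStep S T) (hS : Reduced (imageFinset f S)) :
    Reduced (imageFinset f T) ∧
      core (width (imageFinset f T)) = core (width (imageFinset f S)) := by
  obtain ⟨x, hx, hr, rfl⟩ := h
  have hx' := (imageIso f S).isIrrStar_iff.2 hx
  rw [← (imageIso f S).isRetractible_iff hx] at hr
  have hfx : f x ∈ imageFinset f S := mem_imageFinset.2 ⟨x, x.2, rfl⟩
  change IsRetractible (⟨f x, hfx⟩ : imageFinset f S) at hr
  change IsIrrStar (⟨f x, hfx⟩ : imageFinset f S) at hx'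
  rw [imageFinset_diff_singleton]
  cases hq : f x with
  | node v => exact absurd hx'.isIrr ((hS.isRed_iff _).2 ⟨v, hq⟩)
  | link q i p =>
    simp only [hq] at hr
    have hc := (hS.isRetractible_link_iff _).1 hr
    exact ⟨hS.erase hc, core_width_erase hc⟩

theorem reduced_of_retractSteps {S T : Set α} (h : Relation.ReflTransGen RetractStep S T)
    (hS : Reduced (imageFinset f S)) :
    Reduced (imageFinset f T) ∧
      core (width (imageFinset f T)) = core (width (imageFinset f S)) := by
  induction h with
  | refl => exact ⟨hS, rfl⟩
  | tail _ h ih =>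
    have := h.reduced ih.1
    exact ⟨this.1, this.2.trans ih.2⟩

/-- Every element is reducible or has one cover on each side, so its degree is at least two. This
makes the removal of pendant vertices void. -/
theorem not_isPendant_of_orderIso_reduced {X : Finset Frame} (hX : Reduced X)
    (e : α ≃o X) (x : α) : ¬ IsPendant x := by
  cases h : (e x : Frame) with
  | node v => exact (e.isRed_iff.1 ((hX.isRed_iff _).2 ⟨v, h⟩)).not_isPendant
  | link q i p =>
    have hm : link q i p ∈ X := by rw [← h]; exact Subtype.property _
    have he : e x = ⟨_, hm⟩ := Subtype.ext h
    exact (e.isIrrStar_iff.1 (he ▸ isIrrStar_link hX.node_mem hm)).not_isPendant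

theorem exists_retractSteps (S : Set α) :
    ∃ R : Set α, Relation.ReflTransGen RetractStep S R ∧ IsBasicRetract R := by
  induction hn : S.ncard using Nat.strong_induction_on generalizing S with
  | _ n ih =>
    by_cases hb : IsBasicRetract S
    · exact ⟨S, .refl, hb⟩
    · unfold IsBasicRetract at hb
      push Not at hb
      obtain ⟨x, hx, hr⟩ := hb
      obtain ⟨R, hR, hRb⟩ := ih _ (hn ▸ Set.ncard_sdiff_singleton_lt_of_mem x.2) (S \ {(x : α)}) rfl
      exact ⟨R, .head ⟨x, hx, hr, rfl⟩ hR, hRb⟩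

theorem exists_isAssociatedBasicBlock (hX : Reduced (imageFinset f Set.univ)) :
    ∃ B : Set α, IsAssociatedBasicBlock B := by
  obtain ⟨R, hR, hb⟩ := exists_retractSteps (Set.univ : Set α)
  exact ⟨R, R, ⟨hR, hb⟩, .refl,
    not_isPendant_of_orderIso_reduced (reduced_of_retractSteps hR hX).1 (imageIso f R)⟩

/-- The sizes on the right do not depend on `B`: whatever the order of removals, the result is the
same up to isomorphism. -/
theorem IsAssociatedBasicBlock.exists_orderIso (hX : Reduced (imageFinset f Set.univ)) {B : Set α}
    (hB : IsAssociatedBasicBlock B) :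
    ∃ Y : Finset Frame, Reduced Y ∧ Nonempty (B ≃o Y) ∧
      ∀ q, sizes Y q = Multiset.replicate (core (width (imageFinset f Set.univ)) q) 1 := by
  obtain ⟨R, ⟨hR, hb⟩, hp, -⟩ := hB
  have hred := reduced_of_retractSteps hR hX
  obtain rfl : R = B := by
    rcases hp.cases_head with h | ⟨T, ⟨x, hx, -⟩, -⟩
    · exact h
    · exact absurd hx (not_isPendant_of_orderIso_reduced hred.1 (imageIso f R) x)
  refine ⟨_, hred.1, ⟨imageIso f R⟩, fun q => ?_⟩
  rw [← hred.2]
  exact hred.1.sizes_of_isBasicRetract ((imageIso f R).isBasicRetract_iff.2 hb) q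

end Embedded

/-! ### The height of the basic block -/

/-- `1` if there are strands for the pair `q`, otherwise `0`. -/
def occupied (c : Fin 6 → ℕ) (q : Fin 6) : ℕ := if c q = 0 then 0 else 1

/-- The height of a node if every strand is a singleton. -/
def nodeHeight (d : Fin 6 → ℕ) : Fin 4 → ℕ :=
  ![0, 1 + d 0, 2 + d 0 + d 1, 3 + d 0 + d 1 + d 2]

theorem nodeHeight_strictMono (d : Fin 6 → ℕ) : StrictMono (nodeHeight d) := by
  rw [Fin.strictMono_iff_lt_succ]
  intro i
  fin_cases i <;> simp [nodeHeight] <;> omega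

theorem nodeHeight_src_add_le {d : Fin 6 → ℕ} {q : Fin 6} (hd : d q = 1) :
    nodeHeight d (src q) + 2 ≤ nodeHeight d (tgt q) := by
  fin_cases q <;> simp [nodeHeight, src, tgt] at * <;> omega

namespace Frame

variable {Y : Finset Frame} {c : Fin 6 → ℕ}

/-- A longest chain runs through all four nodes and picks up one further element between consecutive
nodes whenever a strand is there. A strand of a longer pair bypasses a node and gains nothing. -/
theorem krullDim_of_sizes (hY : ∀ v, node v ∈ Y)
    (hs : ∀ q, sizes Y q = Multiset.replicate (c q) 1) :
    Order.krullDim Y = ((3 + occupied c 0 + occupied c 1 + occupied c 2 : ℕ) : WithBot ℕ∞) := by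
  have hw : ∀ q, width Y q = c q := fun q => by rw [← card_sizes, hs, Multiset.card_replicate]
  have hone : ∀ q i p p', link q i p ∈ Y → link q i p' ∈ Y → p = p' := by
    intro q i p p' hp hp'
    have : (strand Y q i).card ∈ sizes Y q :=
      Multiset.mem_sum.2 ⟨i, mem_strands.2 ⟨p, hp⟩, by simp⟩
    rw [hs] at this
    exact Finset.card_le_one.1 (Multiset.eq_of_mem_replicate this).le _ (mem_strand.2 hp) _
      (mem_strand.2 hp')
  have hocc : ∀ q i p, link q i p ∈ Y → occupied c q = 1 := by
    intro q i p hp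
    have : width Y q ≠ 0 := Finset.card_ne_zero.2 ⟨i, mem_strands.2 ⟨p, hp⟩⟩
    rw [hw] at this
    simp [occupied, this]
  set g := nodeHeight (occupied c) with hg
  have hgm : StrictMono g := nodeHeight_strictMono (occupied c)
  have hg3 : g 3 = 3 + occupied c 0 + occupied c 1 + occupied c 2 := rfl
  rw [← hg3]
  apply le_antisymm
  -- Upper bound: a strictly increasing map to ℕ with maximum `g 3` limits the length of every
  -- chain. A strand element gets one more than its source.
  · let h : Y → ℕ := fun x => match x.1 with
      | node v => g v
      | link q _ _ => g (src q) + 1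
    have hh : StrictMono h := by
      rintro ⟨x, hx⟩ ⟨y, hy⟩ hxy
      rw [Subtype.mk_lt_mk] at hxy
      cases x with
      | node v =>
        cases y with
        | node w => exact hgm (node_lt_node.1 hxy)
        | link q i p => exact Nat.lt_succ_of_le (hgm.monotone (node_lt_link.1 hxy))
      | link q i p =>
        have h2 : g (src q) + 2 ≤ g (tgt q) := nodeHeight_src_add_le (hocc q i p hx)
        cases y with
        | node w =>
          have := hgm.monotone (link_lt_node.1 hxy)
          change g (src q) + 1 < g w
          omega
        | link q' i' p' =>
          rcases link_lt_link.1 hxy with ⟨rfl, rfl, h⟩ | h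
          · exact absurd (hone q i p p' hx hy) h.ne
          · have := hgm.monotone h
            change g (src q) + 1 < g (src q') + 1
            omega
    have hle : ∀ x, h x ≤ g 3 := by
      rintro ⟨x, hx⟩
      cases x with
      | node v => exact hgm.monotone (Fin.le_last v)
      | link q i p =>
        exact hgm ((src_lt_tgt q).trans_le (Fin.le_last _))
    refine iSup_le fun l => ?_
    have := (l.map h hh).head_add_length_le_nat
    have h3 := hle l.last
    rw [LTSeries.last_map, LTSeries.map_length] at this
    exact_mod_cast (by omega : l.length ≤ g 3)
  -- Lower bound: heights accumulate along the three consecutive pairs.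
  · have hstep : ∀ q : Fin 6, ¬ 3 ≤ q →
        Order.height (⟨_, hY (src q)⟩ : Y) + 1 + occupied c q ≤
          Order.height (⟨_, hY (tgt q)⟩ : Y) := by
      intro q h3
      unfold occupied
      split_ifs with h0
      · rw [Nat.cast_zero, add_zero]
        refine Order.height_add_one_le ?_
        simpa [← Subtype.coe_lt_coe] using src_lt_tgt q
      · have : 0 < width Y q := by rw [hw]; omega
        obtain ⟨i, hi⟩ := Finset.card_pos.1 this
        obtain ⟨p, hp⟩ := mem_strands.1 hi
        have h1 : Order.height (⟨_, hY (src q)⟩ : Y) + 1 ≤ Order.height (⟨_, hp⟩ : Y) :=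
          Order.height_add_one_le (by simp [← Subtype.coe_lt_coe])
        have h2 : Order.height (⟨_, hp⟩ : Y) + 1 ≤ Order.height (⟨_, hY (tgt q)⟩ : Y) :=
          Order.height_add_one_le (by simp [← Subtype.coe_lt_coe])
        exact (add_le_add_left h1 _).trans h2
    have h0 := hstep 0 (by decide)
    have h1 := hstep 1 (by decide)
    have h2 := hstep 2 (by decide)
    change Order.height (⟨_, hY 0⟩ : Y) + 1 + _ ≤ Order.height (⟨_, hY 1⟩ : Y) at h0
    change Order.height (⟨_, hY 1⟩ : Y) + 1 + _ ≤ Order.height (⟨_, hY 2⟩ : Y) at h1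
    change Order.height (⟨_, hY 2⟩ : Y) + 1 + _ ≤ Order.height (⟨_, hY 3⟩ : Y) at h2
    have h3 := Order.height_le_krullDim (⟨_, hY 3⟩ : Y)
    refine le_trans ?_ h3
    have : ((g 3 : ℕ) : ℕ∞) ≤ Order.height (⟨_, hY 3⟩ : Y) := by
      refine le_trans ?_ h2
      refine le_trans ?_ (add_le_add_left (add_le_add_left h1 _) _)
      refine le_trans ?_
        (add_le_add_left (add_le_add_left (add_le_add_left (add_le_add_left h0 _) _) _) _)
      rw [hg3]
      push_cast
      have : (3 : ℕ∞) + occupied c 0 + occupied c 1 + occupied c 2 =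
        0 + 1 + occupied c 0 + 1 + occupied c 1 + 1 + occupied c 2 := by ring
      rw [this]
      gcongr
      exact zero_le
    exact_mod_cast this

end Frame

/-! ### The nullity -/

namespace Frame

variable {X : Finset Frame}

theorem node_mk_injective (hX : ∀ v, node v ∈ X) :
    Function.Injective fun v => (⟨node v, hX v⟩ : X) :=
  fun _ _ h => node_injective (congrArg Subtype.val h)

theorem ncard_nodes (hX : ∀ v, node v ∈ X) : {x : X | ∃ v, x.1 = node v}.ncard = 4 := by
  have : {x : X | ∃ v, x.1 = node v} = (fun v => (⟨node v, hX v⟩ : X)) '' Set.univ := by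
    ext ⟨x, hx⟩
    simp [eq_comm]
  rw [this, Set.ncard_image_of_injective _ (node_mk_injective hX)]
  simp [Set.ncard_univ]

theorem node_covBy_link_iff (hX : ∀ v, node v ∈ X) {v : Fin 4} {q : Fin 6} {i p : ℕ}
    (h : link q i p ∈ X) :
    (⟨node v, hX v⟩ : X) ⋖ ⟨_, h⟩ ↔ v = src q ∧ ∀ p', link q i p' ∈ X → p ≤ p' := by
  constructor
  · intro hc
    constructor
    · by_contra hne
      exact hc.2 (c := ⟨node (src q), hX _⟩)
        (show (_ : Frame) < _ from node_lt_node.2 (lt_of_le_of_ne (node_lt_link.1 hc.lt) hne))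
        (show (_ : Frame) < _ from node_lt_link.2 le_rfl)
    · intro p' hp'
      by_contra! hlt
      exact hc.2 (c := ⟨_, hp'⟩) (show (_ : Frame) < _ from node_lt_link.2 (node_lt_link.1 hc.lt))
        (show (_ : Frame) < _ from link_lt_link.2 (.inl ⟨rfl, rfl, hlt⟩))
  · rintro ⟨rfl, hp⟩
    refine ⟨show (_ : Frame) < _ from node_lt_link.2 le_rfl, ?_⟩
    rintro ⟨w | ⟨q', i', p'⟩, hw⟩ h1 h2 <;> rw [Subtype.mk_lt_mk] at h1 h2
    · exact (node_lt_node.1 h1).not_ge (node_lt_link.1 h2)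
    · have := src_lt_tgt q'
      rw [node_lt_link] at h1
      rcases link_lt_link.1 h2 with ⟨rfl, rfl, h3⟩ | h3
      · exact h3.not_ge (hp _ hw)
      · omega

theorem node_covBy_node_iff (hX : ∀ v, node v ∈ X) {v w : Fin 4} :
    (⟨node v, hX v⟩ : X) ⋖ ⟨node w, hX w⟩ ↔
      ∃ q, (¬ 3 ≤ q ∧ width X q = 0) ∧ src q = v ∧ tgt q = w := by
  constructor
  · intro hc
    obtain ⟨q, rfl, rfl⟩ := exists_pair v w (node_lt_node.1 hc.lt)
    refine ⟨q, ⟨fun h3 => ?_, ?_⟩, rfl, rfl⟩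
    · obtain ⟨u, h1, h2⟩ := exists_node_between q h3
      exact hc.2 (c := ⟨_, hX u⟩) (show (_ : Frame) < _ from node_lt_node.2 h1)
        (show (_ : Frame) < _ from node_lt_node.2 h2)
    · by_contra hne
      obtain ⟨i, hi⟩ := Finset.card_ne_zero.1 hne
      obtain ⟨p, hp⟩ := mem_strands.1 hi
      exact hc.2 (c := ⟨_, hp⟩) (show (_ : Frame) < _ from node_lt_link.2 le_rfl)
        (show (_ : Frame) < _ from link_lt_node.2 le_rfl)
  · rintro ⟨q, ⟨h3, h0⟩, rfl, rfl⟩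
    refine ⟨show (_ : Frame) < _ from node_lt_node.2 (src_lt_tgt q), ?_⟩
    rintro ⟨w | ⟨q', i', p'⟩, hw⟩ h1 h2 <;> rw [Subtype.mk_lt_mk] at h1 h2
    · exact (not_node_between q h3 w (node_lt_node.1 h1)).not_gt (node_lt_node.1 h2)
    · obtain rfl := pair_eq_of_between q q' h3 (node_lt_link.1 h1) (link_lt_node.1 h2)
      rw [width, Finset.card_eq_zero] at h0
      have := mem_strands.2 ⟨_, hw⟩
      simp [h0] at this

/-- Each strand element has exactly one upper cover, which accounts for `X.card - 4` coverings. The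
coverings starting at a node go either to the least element of a strand or, across an empty
consecutive pair, to the next node. -/
theorem ncard_covBy (hX : ∀ v, node v ∈ X) :
    {p : X × X | p.1 ⋖ p.2}.ncard + 4 =
      X.card + ∑ q, width X q + {q : Fin 6 | ¬ 3 ≤ q ∧ width X q = 0}.ncard := by
  have hlink : ∀ x : X, (¬ ∃ v, x.1 = node v) → ∃! y, x ⋖ y := by
    rintro ⟨v | ⟨q, i, p⟩, hx⟩ h
    · simp at h
    · exact (isIrrStar_link hX hx).2
  have hmin : ∀ s : Σ _ : Fin 6, ℕ, ∃ y : X, s.2 ∈ strands X s.1 →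
      ∃ p, y.1 = link s.1 s.2 p ∧ ∀ p', link s.1 s.2 p' ∈ X → p ≤ p' := by
    rintro ⟨q, i⟩
    by_cases hi : i ∈ strands X q
    · have hne : (strand X q i).Nonempty := by
        obtain ⟨p, hp⟩ := mem_strands.1 hi
        exact ⟨p, mem_strand.2 hp⟩
      exact ⟨⟨_, mem_strand.1 (Finset.min'_mem _ hne)⟩, fun _ => ⟨_, rfl,
        fun p' hp' => Finset.min'_le _ _ (mem_strand.2 hp')⟩⟩
    · exact ⟨⟨_, hX 0⟩, fun h => absurd h hi⟩
  choose m hm using hmin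
  have hup : ∀ x : X, ∃ y : X, (¬ ∃ v, x.1 = node v) → x ⋖ y ∧ ∀ z, x ⋖ z → z = y := fun x => by
    by_cases h : ∃ v, x.1 = node v
    · exact ⟨x, fun h' => absurd h h'⟩
    · obtain ⟨y, hy, hz⟩ := hlink x h
      exact ⟨y, fun _ => ⟨hy, hz⟩⟩
  choose u hu using hup
  have hset : {p : X × X | p.1 ⋖ p.2} =
      (fun x => (x, u x)) '' {x : X | ∃ v, x.1 = node v}ᶜ ∪
        ((fun s : Σ _ : Fin 6, ℕ => ((⟨node (src s.1), hX _⟩, m s) : X × X)) ''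
          ((Finset.univ.sigma fun q => strands X q : Finset (Σ _ : Fin 6, ℕ)) : Set _) ∪
        (fun q => ((⟨node (src q), hX _⟩, ⟨node (tgt q), hX _⟩) : X × X)) ''
          {q : Fin 6 | ¬ 3 ≤ q ∧ width X q = 0}) := by
    ext ⟨⟨x, hx⟩, ⟨y, hy⟩⟩
    constructor
    · intro hc
      change (⟨x, hx⟩ : X) ⋖ ⟨y, hy⟩ at hc
      cases x with
      | link q i p =>
        have hn : ¬ ∃ v, link q i p = node v := by simp
        exact .inl ⟨⟨_, hx⟩, hn, Prod.ext rfl ((hu ⟨_, hx⟩ hn).2 _ hc).symm⟩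
      | node v =>
        right
        cases y with
        | link q i p =>
          left
          obtain ⟨rfl, hp⟩ := (node_covBy_link_iff hX hy).1 hc
          have hi := mem_strands.2 ⟨p, hy⟩
          obtain ⟨p', h1, h2⟩ := hm ⟨q, i⟩ hi
          refine ⟨⟨q, i⟩, by simpa using hi, Prod.ext rfl (Subtype.ext ?_)⟩
          change (m ⟨q, i⟩).1 = link q i p
          have hp' : link q i p' ∈ X := h1 ▸ Subtype.property _
          rw [h1, le_antisymm (hp p' hp') (h2 p hy)]
        | node w =>
          right
          obtain ⟨q, h, rfl, rfl⟩ := (node_covBy_node_iff hX).1 hc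
          exact ⟨q, h, rfl⟩
    · rintro (⟨x', hx', h⟩ | ⟨⟨q, i⟩, hi, h⟩ | ⟨q, hq, h⟩)
      · rw [← h]
        exact (hu x' hx').1
      · rw [← h]
        obtain ⟨p, h1, h2⟩ := hm ⟨q, i⟩ (by simpa using hi)
        have hp : link q i p ∈ X := h1 ▸ Subtype.property _
        have : m ⟨q, i⟩ = ⟨_, hp⟩ := Subtype.ext h1
        change (⟨node (src q), _⟩ : X) ⋖ m ⟨q, i⟩
        rw [this]
        exact (node_covBy_link_iff hX hp).2 ⟨rfl, h2⟩
      · rw [← h]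
        exact (node_covBy_node_iff hX).2 ⟨q, hq, rfl, rfl⟩
  rw [hset, Set.ncard_union_eq, Set.ncard_union_eq, Set.InjOn.ncard_image, Set.InjOn.ncard_image,
    Set.InjOn.ncard_image, Set.ncard_coe_finset, Finset.card_sigma]
  · have h4 := ncard_nodes hX
    have := Set.ncard_add_ncard_compl {x : X | ∃ v, x.1 = node v}
    rw [h4, Nat.card_eq_fintype_card, Fintype.card_coe] at this
    simp only [width]
    omega
  · intro q hq q' hq' h
    simp only [Prod.mk.injEq, Subtype.mk.injEq, node.injEq] at h
    exact pair_ext _ _ h.1 h.2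
  · rintro ⟨q, i⟩ hs ⟨q', i'⟩ hs' h
    obtain ⟨p, h1, -⟩ := hm ⟨q, i⟩ (by simpa using hs)
    obtain ⟨p', h1', -⟩ := hm ⟨q', i'⟩ (by simpa using hs')
    have : m ⟨q, i⟩ = m ⟨q', i'⟩ := congrArg Prod.snd h
    rw [this, h1'] at h1
    simp only [link.injEq] at h1
    rw [h1.1, h1.2.1]
  · exact fun x _ y _ h => congrArg Prod.fst h
  · rw [Set.disjoint_left]
    rintro _ ⟨⟨q, i⟩, hs, rfl⟩ ⟨q', hq', h⟩
    obtain ⟨p, h1, -⟩ := hm ⟨q, i⟩ (by simpa using hs)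
    have : _ = m ⟨q, i⟩ := congrArg Prod.snd h
    rw [← this] at h1
    simp at h1
  · rw [Set.disjoint_left]
    rintro _ ⟨x, hx, rfl⟩ (⟨s, hs, h⟩ | ⟨q, hq, h⟩)
    · exact hx ⟨_, congrArg (fun z : X × X => z.1.1) h.symm⟩
    · exact hx ⟨_, congrArg (fun z : X × X => z.1.1) h.symm⟩

/-- The 3 is the number of nodes minus the single connected component; the number of vertices
cancels. -/
theorem nullity_of_orderIso {α : Type*} [PartialOrder α] (hX : ∀ v, node v ∈ X) (e : α ≃o X) :
    nullity α + 3 =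
      ((∑ q, width X q + {q : Fin 6 | ¬ 3 ≤ q ∧ width X q = 0}.ncard : ℕ) : ℤ) := by
  have : Finite α := Finite.of_equiv _ e.symm.toEquiv
  have hb : IsBot (e.symm ⟨node 0, hX 0⟩) := fun x => by
    rw [e.symm_apply_le]
    exact node_le_iff.2 (Fin.zero_le _)
  have hc : Nat.card α = X.card := by
    rw [Nat.card_congr e.toEquiv, Nat.card_eq_fintype_card, Fintype.card_coe]
  have h := ncard_covBy hX
  rw [nullity, ncard_edgeSet_hasse, card_connectedComponent_hasse hb, e.ncard_covBy, hc]
  omega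

theorem card_eq (hX : ∀ v, node v ∈ X) : X.card = 4 + ∑ q, (sizes X q).sum := by
  classical
  have hset : X = Finset.univ.image node ∪ (Finset.univ.sigma fun q => (strands X q).sigma fun i =>
      strand X q i).image (fun s : Σ _ : Fin 6, Σ _ : ℕ, ℕ => link s.1 s.2.1 s.2.2) := by
    ext x
    simp only [Finset.mem_union, Finset.mem_image, Finset.mem_univ, true_and, Finset.mem_sigma,
      mem_strands, mem_strand]
    constructor
    · intro hx
      cases x with
      | node v => exact .inl ⟨v, rfl⟩
      | link q i p => exact .inr ⟨⟨q, i, p⟩, ⟨⟨p, hx⟩, hx⟩, rfl⟩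
    · rintro (⟨v, rfl⟩ | ⟨s, ⟨-, hs⟩, rfl⟩)
      exacts [hX v, hs]
  conv_lhs => rw [hset]
  rw [Finset.card_union_of_disjoint, Finset.card_image_of_injective _ node_injective,
    Finset.card_image_of_injective, Finset.card_sigma]
  · simp [sum_sizes]
  · rintro ⟨q, i, p⟩ ⟨q', i', p'⟩ h
    simp only [link.injEq] at h
    obtain ⟨rfl, rfl, rfl⟩ := h
    rfl
  · rw [Finset.disjoint_left]
    simp only [Finset.mem_image, Finset.mem_univ, true_and, not_exists, not_and,
      forall_exists_index, forall_apply_eq_imp_iff]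
    simp

end Frame

/-! ### Embedding a block -/

section Embed

variable {α : Type*} [Lattice α]

/-- If `x` and `z` were incomparable, `x ⊔ z` would be a reducible element of the interval from `x`
to `y`. -/
theorem le_or_le_of_forall_not_isReducible_below {x y z : α} (hxy : x ≤ y)
    (hr : ∀ w, x ≤ w → w ≤ y → ¬ IsReducible w) (hz : z ≤ y) : x ≤ z ∨ z ≤ x := by
  have h := hr (x ⊔ z) le_sup_left (sup_le hxy hz)
  by_contra! hn
  exact h (.inr ⟨x, z, fun h => hn.2 (h ▸ le_sup_right), fun h => hn.1 (h ▸ le_sup_left), rfl⟩)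

theorem le_or_le_of_forall_not_isReducible_above {x y z : α} (hxy : x ≤ y)
    (hr : ∀ w, x ≤ w → w ≤ y → ¬ IsReducible w) (hz : x ≤ z) : y ≤ z ∨ z ≤ y := by
  have h := hr (y ⊓ z) (le_inf hxy hz) inf_le_left
  by_contra! hn
  exact h (.inl ⟨y, z, fun h => hn.1 (h ▸ inf_le_right), fun h => hn.2 (h ▸ inf_le_left), rfl⟩)

/-- `x ≤ y` and there is no reducible element between `x` and `y`. -/
def IrredBelow (x y : α) : Prop := x ≤ y ∧ ∀ w, x ≤ w → w ≤ y → ¬ IsReducible w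

/-- Any element between `x` and `z` is comparable with `y`, hence lies in one of the two given
intervals. -/
theorem IrredBelow.trans {x y z : α} (h : IrredBelow x y) (h' : IrredBelow y z) :
    IrredBelow x z := by
  refine ⟨h.1.trans h'.1, fun w hxw hwz => ?_⟩
  rcases le_or_le_of_forall_not_isReducible_above h.1 h.2 hxw with hw | hw
  exacts [h'.2 w hw hwz, h.2 w hxw hw]

variable (α) in
/-- Two irreducible elements lie on the same strand. -/
def strandSetoid : Setoid {x : α // ¬ IsReducible x} where
  r x y := IrredBelow x.1 y.1 ∨ IrredBelow y.1 x.1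
  iseqv :=
    { refl := fun x => .inl ⟨le_rfl, fun w h1 h2 => le_antisymm h1 h2 ▸ x.2⟩
      symm := fun h => h.symm
      trans := by
        rintro ⟨x, hx⟩ ⟨y, hy⟩ ⟨z, hz⟩ (h | h) (h' | h')
        · exact .inl (h.trans h')
        · rcases le_or_le_of_forall_not_isReducible_below h.1 h.2 h'.1 with hle | hle
          · exact .inl ⟨hle, fun w h1 h2 => h.2 w h1 (h2.trans h'.1)⟩
          · exact .inr ⟨hle, fun w h1 h2 => h'.2 w h1 (h2.trans h.1)⟩
        · rcases le_or_le_of_forall_not_isReducible_above h.1 h.2 h'.1 with hle | hle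
          · exact .inl ⟨hle, fun w h1 h2 => h'.2 w (h.1.trans h1) h2⟩
          · exact .inr ⟨hle, fun w h1 h2 => h.2 w (h'.1.trans h1) h2⟩
        · exact .inr (h'.trans h) }

open Frame

/-- A poset is isomorphic to its image. -/
noncomputable def univImageIso {α : Type*} [PartialOrder α] [Finite α] (f : α ↪o Frame) :
    α ≃o imageFinset f Set.univ :=
  OrderIso.Set.univ.symm.trans (imageIso f Set.univ)

theorem exists_node_embedding [Finite α] (h4 : {a : α | IsReducible a}.ncard = 4)
    (hc : IsChain (· ≤ ·) {a : α | IsReducible a}) :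
    ∃ r : Fin 4 ↪o α, ∀ a, IsReducible a ↔ ∃ v, r v = a := by
  classical
  let _ : LinearOrder {a : α // IsReducible a} :=
    { (inferInstance : PartialOrder {a : α // IsReducible a}) with
      le_total := fun a b => hc.total a.2 b.2
      toDecidableLE := Classical.decRel _ }
  have := Fintype.ofFinite {a : α // IsReducible a}
  have hcard : Fintype.card {a : α // IsReducible a} = 4 := by
    rw [← Nat.card_eq_fintype_card, ← h4]
    exact Nat.card_coe_set_eq _
  let e := Fintype.orderIsoFinOfCardEq _ hcard
  refine ⟨e.toOrderEmbedding.trans (OrderEmbedding.subtype _), fun a => ⟨fun ha => ?_, ?_⟩⟩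
  · refine ⟨e.symm ⟨a, ha⟩, ?_⟩
    change (e (e.symm ⟨a, ha⟩)).1 = a
    rw [e.apply_symm_apply]
  · rintro ⟨v, rfl⟩
    exact (e v).2

/-- An irreducible element is sent to the pair of its nearest nodes, to the strand given by its
class in `strandSetoid`, and to a position that increases along the strand. For `x ≤ y` irreducible,
either no reducible element lies between them and they share a strand, or one does and the order is
visible through the nodes. -/
theorem exists_reduced_embedding [Finite α] (hb : IsBlock α)
    (h4 : {a : α | IsReducible a}.ncard = 4) (hc : IsChain (· ≤ ·) {a : α | IsReducible a}) :
    ∃ f : α ↪o Frame, Reduced (imageFinset f Set.univ) := by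
  obtain ⟨r, hr⟩ := exists_node_embedding h4 hc
  have hbot : ∀ x, r 0 ≤ x := by
    obtain ⟨b, hb, hred⟩ := hb.2
    obtain ⟨v, rfl⟩ := (hr _).1 (.inl hred)
    exact fun x => (r.monotone (Fin.zero_le v)).trans (hb x)
  have htop : ∀ x, x ≤ r 3 := by
    obtain ⟨t, ht, hred⟩ := hb.1
    obtain ⟨v, rfl⟩ := (hr _).1 (.inr hred)
    exact fun x => (ht x).trans (r.monotone (Fin.le_last v))
  -- The largest reducible element below `x`; its dual, the smallest one above `x`, comes next.
  -- Bottom and top being reducible guarantees existence.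
  have hs : ∀ x, ∃ v, ∀ w, r w ≤ x ↔ w ≤ v := by
    intro x
    obtain ⟨v, hv⟩ := (Set.toFinite {w | r w ≤ x}).exists_maximal ⟨0, hbot x⟩
    refine ⟨v, fun w => ⟨fun hw => ?_, fun hw => (r.monotone hw).trans hv.1⟩⟩
    exact (le_total w v).elim id fun h => hv.2 hw h
  have ht : ∀ x, ∃ v, ∀ w, x ≤ r w ↔ v ≤ w := by
    intro x
    obtain ⟨v, hv⟩ := (Set.toFinite {w | x ≤ r w}).exists_minimal ⟨3, htop x⟩
    refine ⟨v, fun w => ⟨fun hw => ?_, fun hw => hv.1.trans (r.monotone hw)⟩⟩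
    exact (le_total v w).elim id fun h => hv.2 hw h
  choose s hs using hs
  choose t ht using ht
  have hst : ∀ x, ¬ IsReducible x → s x < t x := by
    intro x hx
    have h1 := (hs x (s x)).2 le_rfl
    have h2 := (ht x (t x)).2 le_rfl
    refine lt_of_le_of_ne (r.le_iff_le.1 (h1.trans h2)) fun h => hx ((hr x).2 ⟨s x, ?_⟩)
    exact le_antisymm h1 (h ▸ h2)
  have hq : ∀ x, ∃ q, ¬ IsReducible x → src q = s x ∧ tgt q = t x := by
    intro x
    by_cases hx : IsReducible x
    · exact ⟨0, fun h => absurd hx h⟩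
    · obtain ⟨q, hq⟩ := exists_pair _ _ (hst x hx)
      exact ⟨q, fun _ => hq⟩
  choose q hq using hq
  have hqeq : ∀ x y, IrredBelow x y → q x = q y := by
    intro x y hxy
    have hx := hq x (hxy.2 x le_rfl hxy.1)
    have hy := hq y (hxy.2 y hxy.1 le_rfl)
    apply pair_ext
    · rw [hx.1, hy.1]
      refine le_antisymm ((hs y _).1 (((hs x _).2 le_rfl).trans hxy.1)) ((hs x _).1 ?_)
      have h := (hs y _).2 le_rfl
      rcases le_or_le_of_forall_not_isReducible_below hxy.1 hxy.2 h with h' | h'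
      · exact absurd ((hr _).2 ⟨_, rfl⟩) (hxy.2 _ h' h)
      · exact h'
    · rw [hx.2, hy.2]
      refine le_antisymm ((ht x _).1 (hxy.1.trans ((ht y _).2 le_rfl))) ((ht y _).1 ?_)
      have h := (ht x _).2 le_rfl
      rcases le_or_le_of_forall_not_isReducible_above hxy.1 hxy.2 h with h' | h'
      · exact h'
      · exact absurd ((hr _).2 ⟨_, rfl⟩) (hxy.2 _ h h')
  -- Any injective numbering of the strands serves, since `Frame` has infinitely many strand indices
  -- for every pair.
  obtain ⟨enc, henc⟩ := exists_injective_nat (Quotient (strandSetoid α))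
  -- The position is the number of elements strictly below `x`. It increases strictly with `x`, and
  -- gaps in the positions are harmless.
  have hf : ∀ x, ∃ y : Frame, (∀ v, r v = x → y = node v) ∧
      ∀ h : ¬ IsReducible x, y = link (q x) (enc (Quotient.mk _ ⟨x, h⟩)) (Set.Iio x).ncard := by
    intro x
    by_cases hx : IsReducible x
    · obtain ⟨v, rfl⟩ := (hr x).1 hx
      exact ⟨node v, fun w hw => by rw [r.injective hw], fun h => absurd hx h⟩
    · exact ⟨link (q x) (enc (Quotient.mk _ ⟨x, hx⟩)) _, fun v hv => absurd ((hr x).2 ⟨v, hv⟩) hx, fun _ => rfl⟩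
  choose f hf1 hf2 using hf
  have hle : ∀ x y, f x ≤ f y ↔ x ≤ y := by
    intro x y
    by_cases hx : IsReducible x
    · obtain ⟨v, rfl⟩ := (hr x).1 hx
      rw [hf1 _ v rfl]
      by_cases hy : IsReducible y
      · obtain ⟨w, rfl⟩ := (hr y).1 hy
        rw [hf1 _ w rfl, node_le_node, r.le_iff_le]
      · rw [hf2 _ hy, node_le_link, (hq y hy).1, hs]
    · by_cases hy : IsReducible y
      · obtain ⟨w, rfl⟩ := (hr y).1 hy
        rw [hf1 _ w rfl, hf2 _ hx, link_le_node, (hq x hx).2, ht]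
      · rw [hf2 _ hx, hf2 _ hy, link_le_link, (hq x hx).2, (hq y hy).1, henc.eq_iff]
        constructor
        · rintro (⟨-, h1, h2⟩ | h)
          · rcases Quotient.exact h1 with h | h
            · exact h.1
            · by_contra hlt
              have : y < x := lt_of_le_not_ge h.1 hlt
              have := Set.ncard_lt_ncard (Set.Iio_ssubset_Iio this)
              omega
          · exact ((ht x _).2 h).trans ((hs y _).2 le_rfl)
        · intro hxy
          by_cases hred : ∀ w, x ≤ w → w ≤ y → ¬ IsReducible w
          · exact .inl ⟨hqeq x y ⟨hxy, hred⟩, Quotient.sound (.inl ⟨hxy, hred⟩),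
              Set.ncard_le_ncard (Set.Iio_subset_Iio hxy)⟩
          · push Not at hred
            obtain ⟨w, h1, h2, hw⟩ := hred
            obtain ⟨v, rfl⟩ := (hr w).1 hw
            exact .inr (((ht x v).1 h1).trans ((hs y v).1 h2))
  let F : α ↪o Frame := OrderEmbedding.ofMapLEIff f hle
  have hmem : ∀ v, node v ∈ imageFinset F Set.univ := fun v =>
    mem_imageFinset.2 ⟨r v, trivial, hf1 _ v rfl⟩
  have hFr : ∀ v, univImageIso F (r v) = ⟨node v, hmem v⟩ := fun v => Subtype.ext (hf1 _ v rfl)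
  refine ⟨F, hmem, fun v => ?_⟩
  rcases (hr (r v)).2 ⟨v, rfl⟩ with h | h
  · rw [isMeetReducible_iff_isProperMeet, ← (univImageIso F).isProperMeet_iff, hFr] at h
    obtain ⟨q, h1, h2⟩ := exists_core_of_isProperMeet hmem h
    exact ⟨q, .inl h2, h1⟩
  · rw [isJoinReducible_iff_isProperJoin, ← (univImageIso F).isProperJoin_iff, hFr] at h
    obtain ⟨q, h1, h2⟩ := exists_core_of_isProperJoin hmem h
    exact ⟨q, .inr h2, h1⟩

/-! ### Realizing a family of strand sizes by a block -/

theorem isReducible_iff_of_orderIso {X : Finset Frame} (hX : Reduced X) (e : α ≃o X) (a : α) :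
    IsReducible a ↔ ∃ v, (e a).1 = node v := by
  rw [IsReducible, isMeetReducible_iff_isProperMeet, isJoinReducible_iff_isProperJoin,
    ← e.isProperMeet_iff, ← e.isProperJoin_iff, hX.isProper_iff]

theorem isRCBlock_of_orderIso {X : Finset Frame} (hX : Reduced X) (e : α ≃o X)
    {k : ℕ} (hk : ∑ q, width X q + {q : Fin 6 | ¬ 3 ≤ q ∧ width X q = 0}.ncard = k + 3) :
    IsRCBlock α 4 k := by
  have hred := isReducible_iff_of_orderIso hX e
  have hbot : ∀ x : X, ⟨node 0, hX.node_mem 0⟩ ≤ x := fun x => node_le_iff.2 (Fin.zero_le _)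
  have htop : ∀ x : X, x ≤ ⟨node 3, hX.node_mem 3⟩ := fun x => le_node_iff.2 (Fin.le_last _)
  refine ⟨⟨⟨e.symm ⟨node 3, hX.node_mem 3⟩, fun x => by simpa [e.le_symm_apply] using htop _, ?_⟩,
    ⟨e.symm ⟨node 0, hX.node_mem 0⟩, fun x => by simpa [e.symm_apply_le] using hbot _, ?_⟩⟩,
    ?_, ?_, ?_⟩
  · rw [isJoinReducible_iff_isProperJoin, e.symm.isProperJoin_iff]
    refine (hX.isProperJoin_or_isProperMeet 3).resolve_right ?_
    rintro ⟨b, -, hb, -⟩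
    -- The top cannot be a proper meet, so its reducibility makes it a proper join; the bottom is
    -- treated dually.
    exact (htop b).not_gt hb
  · rw [isMeetReducible_iff_isProperMeet, e.symm.isProperMeet_iff]
    refine (hX.isProperJoin_or_isProperMeet 0).resolve_left ?_
    rintro ⟨b, -, hb, -⟩
    exact (hbot b).not_gt hb
  · rw [← ncard_nodes hX.node_mem, ← Set.ncard_image_of_injective _ e.injective]
    congr 1
    ext x
    simp only [Set.mem_image, Set.mem_ofPred_eq, hred]
    constructor
    · rintro ⟨a, h, rfl⟩
      exact h
    · exact fun h => ⟨e.symm x, by simpa using h, by simp⟩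
  · intro a ha b hb _
    obtain ⟨v, hv⟩ := (hred a).1 ha
    obtain ⟨w, hw⟩ := (hred b).1 hb
    change a ≤ b ∨ b ≤ a
    rw [← e.le_iff_le, ← e.le_iff_le, ← Subtype.coe_le_coe, ← Subtype.coe_le_coe, hv, hw]
    exact le_total v w
  · have := nullity_of_orderIso hX.node_mem e
    rw [hk] at this
    push_cast at this
    omega

theorem sum_range_getD_singleton (l : List ℕ) :
    ∑ i ∈ Finset.range l.length, ({l.getD i 0} : Multiset ℕ) = (l : Multiset ℕ) := by
  induction l with
  | nil => rfl
  | cons a l ih =>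
    rw [List.length_cons, Finset.sum_range_succ']
    simp only [List.getD_cons_succ, List.getD_cons_zero]
    rw [ih, add_comm]
    rfl

namespace Frame

/-- The nodes together with strands of prescribed sizes. -/
noncomputable def ofSizes (F : Fin 6 → Multiset ℕ) : Finset Frame :=
  Finset.univ.image node ∪
    (Finset.univ.sigma fun q => (Finset.range (F q).toList.length).sigma fun i =>
      Finset.range ((F q).toList.getD i 0)).image
        (fun s : Σ _ : Fin 6, Σ _ : ℕ, ℕ => link s.1 s.2.1 s.2.2)

variable {F : Fin 6 → Multiset ℕ}

theorem node_mem_ofSizes (v : Fin 4) : node v ∈ ofSizes F := by simp [ofSizes]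

theorem link_mem_ofSizes {q : Fin 6} {i p : ℕ} :
    link q i p ∈ ofSizes F ↔ i < (F q).toList.length ∧ p < (F q).toList.getD i 0 := by
  simp only [ofSizes, Finset.mem_union, Finset.mem_image, Finset.mem_univ, reduceCtorEq,
    and_false, exists_false, Finset.mem_sigma, Finset.mem_range, true_and, false_or]
  constructor
  · rintro ⟨⟨q', i', p'⟩, h, h'⟩
    simp only [link.injEq] at h'
    obtain ⟨rfl, rfl, rfl⟩ := h'
    exact h
  · exact fun h => ⟨⟨q, i, p⟩, h, rfl⟩

theorem sizes_ofSizes (hF : ∀ q, 0 ∉ F q) : sizes (ofSizes F) = F := by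
  funext q
  have h1 : strands (ofSizes F) q = Finset.range (F q).toList.length := by
    ext i
    simp only [mem_strands, link_mem_ofSizes, Finset.mem_range]
    refine ⟨fun ⟨_, h, _⟩ => h, fun h => ⟨0, h, ?_⟩⟩
    rw [List.getD_eq_getElem _ _ h]
    refine Nat.pos_of_ne_zero fun h0 => hF q ?_
    rw [← Multiset.mem_toList, ← h0]
    exact List.getElem_mem h
  have h2 : ∀ i ∈ Finset.range (F q).toList.length,
      strand (ofSizes F) q i = Finset.range ((F q).toList.getD i 0) := by
    intro i hi
    ext p
    rw [Finset.mem_range] at hi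
    simp [mem_strand, link_mem_ofSizes, -List.getD_eq_getElem?_getD, -Multiset.length_toList, hi]
  rw [sizes, h1, Finset.sum_congr rfl fun i hi => by rw [h2 i hi, Finset.card_range],
    sum_range_getD_singleton, Multiset.coe_toList]

/-! ### Lattice structure on sets that contain all nodes -/

variable {X : Finset Frame}

/-- Joins and meets of incomparable elements are nodes. -/
noncomputable abbrev latticeOfNodes (hX : ∀ v, node v ∈ X) : Lattice X :=
  { (inferInstance : PartialOrder X) with
    sup := fun x y => if x ≤ y then y else if y ≤ x then x else
      ⟨node (max x.1.upper y.1.upper), hX _⟩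
    inf := fun x y => if x ≤ y then x else if y ≤ x then y else
      ⟨node (min x.1.lower y.1.lower), hX _⟩
    le_sup_left := fun x y => by
      split_ifs with h1 h2
      exacts [h1, le_rfl, le_node_iff.2 (le_max_left _ _)]
    le_sup_right := fun x y => by
      split_ifs with h1 h2
      exacts [le_rfl, h2, le_node_iff.2 (le_max_right _ _)]
    sup_le := fun x y z hx hy => by
      split_ifs with h1 h2
      · exact hy
      · exact hx
      · obtain ⟨z, hz⟩ := z
        cases z with
        | node v => exact node_le_node.2 (max_le (le_node_iff.1 hx) (le_node_iff.1 hy))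
        | link q i p =>
          have hx' : x.1 ≠ link q i p := fun h => h2 (hy.trans (show (_ : Frame) ≤ _ from h.ge))
          have hy' : y.1 ≠ link q i p := fun h => h1 (hx.trans (show (_ : Frame) ≤ _ from h.ge))
          rcases le_or_le_or_of_lt_link (lt_of_le_of_ne hx hx') (lt_of_le_of_ne hy hy') with
            (h | h) | ⟨h, h'⟩
          · exact absurd h h1
          · exact absurd h h2
          · exact node_le_link.2 (max_le (le_node_iff.1 h) (le_node_iff.1 h'))
    inf_le_left := fun x y => by
      split_ifs with h1 h2
      exacts [le_rfl, h2, node_le_iff.2 (min_le_left _ _)]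
    inf_le_right := fun x y => by
      split_ifs with h1 h2
      exacts [h1, le_rfl, node_le_iff.2 (min_le_right _ _)]
    le_inf := fun z x y hx hy => by
      split_ifs with h1 h2
      · exact hx
      · exact hy
      · obtain ⟨z, hz⟩ := z
        cases z with
        | node v => exact node_le_node.2 (le_min (node_le_iff.1 hx) (node_le_iff.1 hy))
        | link q i p =>
          have hx' : link q i p ≠ x.1 := fun h => h1 ((show (_ : Frame) ≤ _ from h.ge).trans hy)
          have hy' : link q i p ≠ y.1 := fun h => h2 ((show (_ : Frame) ≤ _ from h.ge).trans hx)
          rcases le_or_le_or_of_link_lt (lt_of_le_of_ne hx hx') (lt_of_le_of_ne hy hy') with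
            (h | h) | ⟨h, h'⟩
          · exact absurd h h1
          · exact absurd h h2
          · exact link_le_node.2 (le_min (node_le_iff.1 h) (node_le_iff.1 h')) }

theorem exists_lattice_fin (hX : ∀ v, node v ∈ X) {j : ℕ} (hj : X.card = j) :
    ∃ L : Lattice (Fin j), Nonempty (@OrderIso (Fin j) X L.toLE _) := by
  let g : Fin j ≃ X := (finCongr hj.symm).trans X.equivFin.symm
  let LX := latticeOfNodes hX
  let P : PartialOrder (Fin j) := PartialOrder.lift g g.injective
  let L : Lattice (Fin j) :=
    { P with
      sup := fun a b => g.symm (LX.sup (g a) (g b))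
      inf := fun a b => g.symm (LX.inf (g a) (g b))
      le_sup_left := fun a b => by
        change g a ≤ g (g.symm _)
        rw [g.apply_symm_apply]
        exact LX.le_sup_left _ _
      le_sup_right := fun a b => by
        change g b ≤ g (g.symm _)
        rw [g.apply_symm_apply]
        exact LX.le_sup_right _ _
      sup_le := fun a b c h1 h2 => by
        change g (g.symm _) ≤ g c
        rw [g.apply_symm_apply]
        exact LX.sup_le _ _ _ h1 h2
      inf_le_left := fun a b => by
        change g (g.symm _) ≤ g a
        rw [g.apply_symm_apply]
        exact LX.inf_le_left _ _
      inf_le_right := fun a b => by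
        change g (g.symm _) ≤ g b
        rw [g.apply_symm_apply]
        exact LX.inf_le_right _ _
      le_inf := fun a b c h1 h2 => by
        change g a ≤ g (g.symm _)
        rw [g.apply_symm_apply]
        exact LX.le_inf _ _ _ h1 h2 }
  exact ⟨L, ⟨{ toEquiv := g, map_rel_iff' := Iff.rfl }⟩⟩

end Frame

end Embed

/-! ### The nine basic blocks of height four -/

/-- The numbers of strands of the nine basic blocks. -/
def coreType : Fin 9 → Fin 6 → ℕ :=
  ![![0, 3, 0, 0, 0, 1],
    ![0, 2, 0, 0, 0, 2],
    ![0, 0, 2, 1, 1, 0],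
    ![2, 0, 0, 1, 1, 0],
    ![0, 0, 2, 0, 1, 1],
    ![2, 0, 0, 1, 0, 1],
    ![0, 2, 0, 1, 0, 1],
    ![0, 2, 0, 0, 1, 1],
    ![0, 2, 0, 1, 1, 0]]

theorem coreType_injective : Function.Injective coreType := by decide

theorem touched_coreType : ∀ i, Touched (coreType i) := by decide

namespace HeightFourBlock

open Frame

/-- The pair of consecutive nodes with several strands. -/
def midPair : Fin 9 → Fin 3 := ![1, 1, 2, 0, 2, 0, 1, 1, 1]

/-- The pairs of nodes of the three extra elements. -/
def extraPair : Fin 9 → Fin 3 → Fin 6 :=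
  ![![1, 1, 5], ![1, 5, 5], ![4, 2, 3], ![3, 0, 4], ![4, 2, 5], ![3, 0, 5], ![1, 3, 5],
    ![1, 4, 5], ![1, 3, 4]]

/-- The chain contains the nodes and one element of a strand. -/
def chainImage (i : Fin 9) (u : Fin 5) : Frame :=
  -- The chain has five elements but only four nodes. Its surplus element follows the lower node of
  -- `midPair i` and represents strand 0 of that pair; `predAbove` closes the gap in the numbering
  -- of the nodes.
  if u = (midPair i).succ.castSucc then link ((midPair i).castAdd 3) 0 0
  else node ((midPair i).succ.predAbove u)

/-- The extra elements lie on strands of their own. -/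
def extraImage (i : Fin 9) (k : Fin 3) : Frame := link (extraPair i k) (k + 1) 0

/-- The embedding of the basic block into the ambient poset. -/
def toFrame (i : Fin 9) : HeightFourBlock i → Frame
  | chain u => chainImage i u
  | extra k => extraImage i k

/-- The image of the basic block in the ambient poset. -/
def frameImage (i : Fin 9) : Finset Frame :=
  Finset.univ.image (chainImage i) ∪ Finset.univ.image (extraImage i)

theorem chainImage_le_chainImage : ∀ i u v, chainImage i u ≤ chainImage i v ↔ u ≤ v := by decide

theorem chainImage_le_extraImage :
    ∀ i u k, chainImage i u ≤ extraImage i k ↔ u ≤ (adjunctPairs i k).1 := by decide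

theorem extraImage_le_chainImage :
    ∀ i k v, extraImage i k ≤ chainImage i v ↔ (adjunctPairs i k).2 ≤ v := by decide

theorem extraImage_le_extraImage : ∀ i k l, extraImage i k ≤ extraImage i l ↔
    k = l ∨ (adjunctPairs i k).2 ≤ (adjunctPairs i l).1 := by decide

theorem node_mem_frameImage : ∀ i v, node v ∈ frameImage i := by decide

theorem sizes_frameImage : ∀ i q, sizes (frameImage i) q = Multiset.replicate (coreType i q) 1 := by
  decide

theorem width_frameImage (i : Fin 9) : width (frameImage i) = coreType i := by
  funext q
  rw [← card_sizes, sizes_frameImage, Multiset.card_replicate]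

theorem reduced_frameImage (i : Fin 9) : Reduced (frameImage i) :=
  ⟨node_mem_frameImage i, by rw [width_frameImage]; exact touched_coreType i⟩

theorem nonempty_orderIso_frameImage (i : Fin 9) :
    Nonempty (HeightFourBlock i ≃o frameImage i) := by
  have hmem : ∀ x, toFrame i x ∈ frameImage i := by
    rintro (u | k)
    · exact Finset.mem_union_left _ (Finset.mem_image_of_mem _ (Finset.mem_univ u))
    · exact Finset.mem_union_right _ (Finset.mem_image_of_mem _ (Finset.mem_univ k))
  refine ⟨RelIso.ofSurjective (OrderEmbedding.ofMapLEIff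
    (fun x => (⟨toFrame i x, hmem x⟩ : frameImage i)) ?_) ?_⟩
  · rintro (u | k) (v | l)
    · exact chainImage_le_chainImage i u v
    · exact chainImage_le_extraImage i u l
    · exact extraImage_le_chainImage i k v
    · exact extraImage_le_extraImage i k l
  · rintro ⟨x, hx⟩
    rcases Finset.mem_union.1 hx with h | h
    · obtain ⟨u, -, rfl⟩ := Finset.mem_image.1 h
      exact ⟨chain u, rfl⟩
    · obtain ⟨k, -, rfl⟩ := Finset.mem_image.1 h
      exact ⟨extra k, rfl⟩

end HeightFourBlock

/-! ### Classification of the core vectors by nullity and height -/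

theorem ncard_empty_consecutive (n : Fin 6 → ℕ) : {q : Fin 6 | ¬ 3 ≤ q ∧ n q = 0}.ncard =
    (if n 0 = 0 then 1 else 0) + (if n 1 = 0 then 1 else 0) + (if n 2 = 0 then 1 else 0) := by
  have : {q : Fin 6 | ¬ 3 ≤ q ∧ n q = 0} =
      ((Finset.univ.filter fun q : Fin 6 => ¬ 3 ≤ q ∧ n q = 0 : Finset (Fin 6)) : Set (Fin 6)) := by
    ext; simp
  rw [this, Set.ncard_coe_finset, Finset.card_filter, Fin.sum_univ_six]
  simp [show ¬ (3 : Fin 6) ≤ 0 by decide, show ¬ (3 : Fin 6) ≤ 1 by decide,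
    show ¬ (3 : Fin 6) ≤ 2 by decide, show (3 : Fin 6) ≤ 4 by decide,
    show (3 : Fin 6) ≤ 5 by decide]

theorem core_of_not_three_le (n : Fin 6 → ℕ) {q : Fin 6} (hq : ¬ 3 ≤ q) :
    core n q = if 2 ≤ n q then n q else 0 := by
  simp [core, hq]

theorem core_eq_iff (n c : Fin 6 → ℕ) : core n = c ↔
    (if 2 ≤ n 0 then n 0 else 0) = c 0 ∧ (if 2 ≤ n 1 then n 1 else 0) = c 1 ∧
    (if 2 ≤ n 2 then n 2 else 0) = c 2 ∧ n 3 = c 3 ∧ n 4 = c 4 ∧ n 5 = c 5 := by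
  rw [← core_of_not_three_le n (q := 0) (by decide), ← core_of_not_three_le n (q := 1) (by decide),
    ← core_of_not_three_le n (q := 2) (by decide), funext_iff]
  constructor
  · intro h
    exact ⟨h 0, h 1, h 2, h 3, h 4, h 5⟩
  · rintro ⟨h0, h1, h2, h3, h4, h5⟩ q
    fin_cases q
    exacts [h0, h1, h2, h3, h4, h5]

/-- A consecutive pair with core 0 contributes exactly 1, as a lone strand or as an empty pair. So
the nullity depends only on the core, and the nine vectors can be checked one by one. -/
theorem sum_width_of_core_eq {n : Fin 6 → ℕ} {i : Fin 9} (h : core n = coreType i) :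
    ∑ q, n q + {q : Fin 6 | ¬ 3 ≤ q ∧ n q = 0}.ncard = 6 := by
  rw [core_eq_iff] at h
  rw [ncard_empty_consecutive, Fin.sum_univ_six]
  have key : ∀ m c : ℕ, (if 2 ≤ m then m else 0) = c →
      m + (if m = 0 then 1 else 0) = if c = 0 then 1 else c := by
    intro m c h
    split_ifs at * <;> omega
  have hi : ∀ i, (if coreType i 0 = 0 then 1 else coreType i 0) +
      (if coreType i 1 = 0 then 1 else coreType i 1) +
      (if coreType i 2 = 0 then 1 else coreType i 2) +
      coreType i 3 + coreType i 4 + coreType i 5 = 6 := by decide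
  have := hi i
  rw [← key _ _ h.1, ← key _ _ h.2.1, ← key _ _ h.2.2.1, ← h.2.2.2.1, ← h.2.2.2.2.1,
    ← h.2.2.2.2.2] at this
  omega

theorem touched_of_core_eq {n : Fin 6 → ℕ} {i : Fin 9} (h : core n = coreType i) : Touched n := by
  intro v
  obtain ⟨q, hq, hc⟩ := touched_coreType i v
  refine ⟨q, hq, fun h0 => hc ?_⟩
  have := congrFun h q
  rw [h0] at this
  simp [core, ← this]

theorem touched_iff (n : Fin 6 → ℕ) : Touched n ↔
    (core n 0 ≠ 0 ∨ n 3 ≠ 0 ∨ n 5 ≠ 0) ∧ (core n 0 ≠ 0 ∨ core n 1 ≠ 0 ∨ n 4 ≠ 0) ∧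
    (core n 1 ≠ 0 ∨ core n 2 ≠ 0 ∨ n 3 ≠ 0) ∧ (core n 2 ≠ 0 ∨ n 4 ≠ 0 ∨ n 5 ≠ 0) := by
  have h3 : core n 3 = n 3 := rfl
  have h4 : core n 4 = n 4 := rfl
  have h5 : core n 5 = n 5 := rfl
  have h6 : ∀ P : Fin 6 → Prop, (∃ q, P q) ↔ P 0 ∨ P 1 ∨ P 2 ∨ P 3 ∨ P 4 ∨ P 5 := fun P =>
    ⟨fun ⟨q, hq⟩ => by fin_cases q <;> simp_all, by rintro (h | h | h | h | h | h) <;> exact ⟨_, h⟩⟩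
  have h7 : ∀ P : Fin 4 → Prop, (∀ q, P q) ↔ P 0 ∧ P 1 ∧ P 2 ∧ P 3 := fun P =>
    ⟨fun h => ⟨h 0, h 1, h 2, h 3⟩, fun ⟨h0, h1, h2, h3⟩ q => by fin_cases q <;> assumption⟩
  unfold Touched
  simp only [h6, h7, h3, h4, h5]
  simp [src, tgt]

/-- Height four singles out one consecutive pair with at least two strands. The other two contribute
1 each to the total of 6, so this pair and the three long pairs share four strands. Requiring each
node to be an end of a core strand leaves two, five or two solutions, according to whether the pair
is lowest, middle or highest. -/
theorem exists_core_eq_iff {n : Fin 6 → ℕ} (ht : Touched n)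
    (hn : ∑ q, n q + {q : Fin 6 | ¬ 3 ≤ q ∧ n q = 0}.ncard = 6) :
    3 + occupied (core n) 0 + occupied (core n) 1 + occupied (core n) 2 = 4 ↔
      ∃ i, core n = coreType i := by
  rw [ncard_empty_consecutive, Fin.sum_univ_six] at hn
  rw [touched_iff] at ht
  have c0 := core_of_not_three_le n (q := 0) (by decide)
  have c1 := core_of_not_three_le n (q := 1) (by decide)
  have c2 := core_of_not_three_le n (q := 2) (by decide)
  simp only [core_eq_iff, occupied, c0, c1, c2] at *
  generalize n 0 = n0 at *
  generalize n 1 = n1 at *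
  generalize n 2 = n2 at *
  generalize n 3 = n3 at *
  generalize n 4 = n4 at *
  generalize n 5 = n5 at *
  constructor
  · intro h
    have hocc : ∀ m : ℕ, (if (if 2 ≤ m then m else 0) = 0 then 0 else 1) =
        if 2 ≤ m then 1 else 0 := by
      intro m
      split_ifs <;> omega
    rw [hocc, hocc, hocc] at h
    by_cases h0 : 2 ≤ n0 <;> by_cases h1 : 2 ≤ n1 <;> by_cases h2 : 2 ≤ n2 <;>
      simp only [h0, h1, h2, if_true, if_false] at h ht ⊢ <;> try omega
    · have hs : n0 + n3 + n4 + n5 = 4 := by split_ifs at hn <;> omega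
      have : (n0 = 2 ∧ n3 = 1 ∧ n4 = 1 ∧ n5 = 0) ∨ (n0 = 2 ∧ n3 = 1 ∧ n4 = 0 ∧ n5 = 1) := by omega
      rcases this with ⟨rfl, rfl, rfl, rfl⟩ | ⟨rfl, rfl, rfl, rfl⟩
      exacts [⟨3, by simp [coreType]⟩, ⟨5, by simp [coreType]⟩]
    · have hs : n1 + n3 + n4 + n5 = 4 := by split_ifs at hn <;> omega
      have : (n1 = 3 ∧ n3 = 0 ∧ n4 = 0 ∧ n5 = 1) ∨ (n1 = 2 ∧ n3 = 0 ∧ n4 = 0 ∧ n5 = 2) ∨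
          (n1 = 2 ∧ n3 = 1 ∧ n4 = 0 ∧ n5 = 1) ∨ (n1 = 2 ∧ n3 = 0 ∧ n4 = 1 ∧ n5 = 1) ∨
          (n1 = 2 ∧ n3 = 1 ∧ n4 = 1 ∧ n5 = 0) := by omega
      rcases this with ⟨rfl, rfl, rfl, rfl⟩ | ⟨rfl, rfl, rfl, rfl⟩ | ⟨rfl, rfl, rfl, rfl⟩ |
        ⟨rfl, rfl, rfl, rfl⟩ | ⟨rfl, rfl, rfl, rfl⟩
      exacts [⟨0, by simp [coreType]⟩, ⟨1, by simp [coreType]⟩, ⟨6, by simp [coreType]⟩,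
        ⟨7, by simp [coreType]⟩, ⟨8, by simp [coreType]⟩]
    · have hs : n2 + n3 + n4 + n5 = 4 := by split_ifs at hn <;> omega
      have : (n2 = 2 ∧ n3 = 1 ∧ n4 = 1 ∧ n5 = 0) ∨ (n2 = 2 ∧ n3 = 0 ∧ n4 = 1 ∧ n5 = 1) := by omega
      rcases this with ⟨rfl, rfl, rfl, rfl⟩ | ⟨rfl, rfl, rfl, rfl⟩
      exacts [⟨2, by simp [coreType]⟩, ⟨4, by simp [coreType]⟩]
  · rintro ⟨i, h0, h1, h2, -⟩
    rw [h0, h1, h2]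
    fin_cases i <;> rfl

/-! ### Isomorphism classes and families of strand sizes -/

section Classes

open Frame

variable {α : Type*}

theorem exists_reduced_orderIso [Lattice α] [Finite α] {k : ℕ} (h : IsRCBlock α 4 k) :
    ∃ X : Finset Frame, Reduced X ∧ Nonempty (α ≃o X) ∧
      ∑ q, width X q + {q : Fin 6 | ¬ 3 ≤ q ∧ width X q = 0}.ncard = k + 3 := by
  obtain ⟨f, hf⟩ := exists_reduced_embedding h.1 h.2.1 h.2.2.1
  refine ⟨_, hf, ⟨univImageIso f⟩, ?_⟩
  have := nullity_of_orderIso hf.node_mem (univImageIso f)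
  rw [h.2.2.2] at this
  exact_mod_cast this.symm

theorem exists_embedding_of_orderIso [PartialOrder α] [Finite α] {X : Finset Frame} (e : α ≃o X) :
    ∃ f : α ↪o Frame, imageFinset f Set.univ = X := by
  refine ⟨e.toOrderEmbedding.trans (OrderEmbedding.subtype _), ?_⟩
  ext x
  rw [mem_imageFinset]
  constructor
  · rintro ⟨a, -, rfl⟩
    exact (e a).2
  · intro hx
    refine ⟨e.symm ⟨x, hx⟩, trivial, ?_⟩
    change (e (e.symm ⟨x, hx⟩)).1 = x
    rw [e.apply_symm_apply]

/-- The associated basic block and `HeightFourBlock i` both correspond to families of singleton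
strands, and such families are isomorphic only if their numbers of strands agree. -/
theorem hasBasicBlock_iff [PartialOrder α] {X : Finset Frame} (hX : Reduced X) (e : α ≃o X)
    (i : Fin 9) : HasBasicBlock α (HeightFourBlock i) ↔ core (width X) = coreType i := by
  have : Finite α := Finite.of_equiv _ e.symm.toEquiv
  obtain ⟨f, rfl⟩ := exists_embedding_of_orderIso e
  obtain ⟨g⟩ := HeightFourBlock.nonempty_orderIso_frameImage i
  constructor
  · rintro ⟨B, hB, ⟨h⟩⟩
    obtain ⟨Y, hY, ⟨e'⟩, hs⟩ := hB.exists_orderIso hX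
    have := hY.sizes_eq_of_orderIso (HeightFourBlock.reduced_frameImage i)
      ((e'.symm.trans h).trans g)
    funext q
    have h1 := hs q
    rw [this, HeightFourBlock.sizes_frameImage] at h1
    exact (Multiset.replicate_left_injective _ h1).symm
  · intro hc
    obtain ⟨B, hB⟩ := exists_isAssociatedBasicBlock hX
    obtain ⟨Y, hY, ⟨e'⟩, hs⟩ := hB.exists_orderIso hX
    obtain ⟨h⟩ := nonempty_orderIso_of_sizes_eq hY.node_mem (HeightFourBlock.node_mem_frameImage i)
      (by funext q; rw [hs, HeightFourBlock.sizes_frameImage, hc])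
    exact ⟨B, hB, ⟨(e'.trans h).trans g.symm⟩⟩

theorem hasBasicBlockOfHeight_iff [PartialOrder α] {X : Finset Frame} (hX : Reduced X)
    (e : α ≃o X) (h : ℕ) : HasBasicBlockOfHeight α h ↔
      3 + occupied (core (width X)) 0 + occupied (core (width X)) 1 +
        occupied (core (width X)) 2 = h := by
  have : Finite α := Finite.of_equiv _ e.symm.toEquiv
  obtain ⟨f, rfl⟩ := exists_embedding_of_orderIso e
  have key : ∀ B : Set α, IsAssociatedBasicBlock B → (Order.krullDim B = (h : WithBot ℕ∞) ↔
      3 + occupied (core (width (imageFinset f Set.univ))) 0 +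
        occupied (core (width (imageFinset f Set.univ))) 1 +
        occupied (core (width (imageFinset f Set.univ))) 2 = h) := by
    intro B hB
    obtain ⟨Y, hY, ⟨e'⟩, hs⟩ := hB.exists_orderIso hX
    rw [Order.krullDim_eq_of_orderIso e', krullDim_of_sizes hY.node_mem hs]
    norm_cast
  constructor
  · rintro ⟨B, hB, h⟩
    exact (key B hB).1 h
  · intro h
    obtain ⟨B, hB⟩ := exists_isAssociatedBasicBlock hX
    exact ⟨B, hB, (key B hB).2 h⟩

/-- The families of strand sizes of the blocks with `j` elements and the `i`-th basic block. -/
def sizeFamilies (i : Fin 9) (j : ℕ) : Set (Fin 6 → Multiset ℕ) :=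
  {F | (∀ q, 0 ∉ F q) ∧ core (fun q => Multiset.card (F q)) = coreType i ∧
    4 + ∑ q, (F q).sum = j}

theorem width_eq_card_sizes (X : Finset Frame) : width X = fun q => Multiset.card (sizes X q) :=
  funext fun _ => card_sizes.symm

theorem reduced_ofSizes {i : Fin 9} {j : ℕ} {F : Fin 6 → Multiset ℕ} (hF : F ∈ sizeFamilies i j) :
    Reduced (ofSizes F) ∧ sizes (ofSizes F) = F ∧ core (width (ofSizes F)) = coreType i ∧
      (ofSizes F).card = j := by
  have hs := sizes_ofSizes hF.1
  have hc : core (width (ofSizes F)) = coreType i := by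
    rw [width_eq_card_sizes, hs, hF.2.1]
  refine ⟨⟨node_mem_ofSizes, touched_of_core_eq hc⟩, hs, hc, ?_⟩
  rw [card_eq node_mem_ofSizes, hs, hF.2.2]

theorem mem_sizeFamilies [PartialOrder α] {X : Finset Frame} (hX : Reduced X)
    (e : α ≃o X) (i : Fin 9) (hb : HasBasicBlock α (HeightFourBlock i)) :
    sizes X ∈ sizeFamilies i (Nat.card α) := by
  refine ⟨fun q => zero_notMem_sizes, ?_, ?_⟩
  · rw [← width_eq_card_sizes]
    exact (hasBasicBlock_iff hX e i).1 hb
  · rw [← card_eq hX.node_mem]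
    simpa using (Nat.card_congr e.toEquiv).symm

theorem sizes_eq_of_orderIso_orderIso {β : Type*} [PartialOrder α] [PartialOrder β]
    {X Y : Finset Frame} (hX : Reduced X) (hY : Reduced Y) (e : α ≃o X) (e' : β ≃o Y)
    (g : α ≃o β) : sizes X = sizes Y :=
  hX.sizes_eq_of_orderIso hY ((e.symm.trans g).trans e')

theorem nonempty_orderIso_of_orderIso_orderIso {β : Type*} [PartialOrder α] [PartialOrder β]
    {X Y : Finset Frame} (hX : ∀ v, node v ∈ X) (hY : ∀ v, node v ∈ Y) (e : α ≃o X) (e' : β ≃o Y)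
    (h : sizes X = sizes Y) : Nonempty (α ≃o β) := by
  obtain ⟨g⟩ := nonempty_orderIso_of_sizes_eq hX hY h
  exact ⟨(e.trans g).trans e'.symm⟩

open Classical in
/-- The isomorphism class of the lattices with prescribed strand sizes. -/
noncomputable def classOfSizes (j : ℕ) (F : Fin 6 → Multiset ℕ) : LatticeClass j :=
  if h : (ofSizes F).card = j then
    Quotient.mk (latticeSetoid j) (exists_lattice_fin node_mem_ofSizes h).choose
  -- A default value, not reached on `sizeFamilies i j`.
  else Quotient.mk (latticeSetoid j) inferInstance

theorem classOfSizes_eq {i : Fin 9} {j : ℕ} {F : Fin 6 → Multiset ℕ} (hF : F ∈ sizeFamilies i j) :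
    ∃ L : Lattice (Fin j), classOfSizes j F = Quotient.mk (latticeSetoid j) L ∧
      Nonempty (@OrderIso (Fin j) (ofSizes F) L.toLE _) := by
  have h := (reduced_ofSizes hF).2.2.2
  refine ⟨_, ?_, (exists_lattice_fin node_mem_ofSizes h).choose_spec⟩
  exact dif_pos h

theorem classOfSizes_injOn {i i' : Fin 9} {j : ℕ} {F F' : Fin 6 → Multiset ℕ}
    (hF : F ∈ sizeFamilies i j) (hF' : F' ∈ sizeFamilies i' j)
    (h : classOfSizes j F = classOfSizes j F') : F = F' := by
  obtain ⟨L, hL, ⟨e⟩⟩ := classOfSizes_eq hF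
  obtain ⟨L', hL', ⟨e'⟩⟩ := classOfSizes_eq hF'
  rw [hL, hL'] at h
  obtain ⟨g⟩ := Quotient.exact h
  have hr := reduced_ofSizes hF
  have hr' := reduced_ofSizes hF'
  have := @sizes_eq_of_orderIso_orderIso _ _ L.toPartialOrder L'.toPartialOrder _ _ hr.1 hr'.1 e e' g
  rwa [hr.2.1, hr'.2.1] at this

/-- A block has the same strand sizes as the model built by `ofSizes`, hence is isomorphic to it;
conversely, the core of the model yields the four nodes, the nullity and the basic block. -/
theorem typedBlockClass_eq_image (i : Fin 9) (j : ℕ) :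
    typedBlockClass i j = classOfSizes j '' sizeFamilies i j := by
  ext c
  constructor
  · rintro ⟨L, ⟨hL, hb⟩, rfl⟩
    obtain ⟨X, hX, ⟨e⟩, -⟩ := @exists_reduced_orderIso (Fin j) L _ 3 hL
    have hF := @mem_sizeFamilies (Fin j) L.toPartialOrder _ hX e i hb
    rw [Nat.card_fin] at hF
    refine ⟨sizes X, hF, ?_⟩
    obtain ⟨L', hL', ⟨e'⟩⟩ := classOfSizes_eq hF
    rw [hL']
    exact Quotient.sound (@nonempty_orderIso_of_orderIso_orderIso _ _ L'.toPartialOrder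
      L.toPartialOrder _ _ node_mem_ofSizes hX.node_mem e' e (reduced_ofSizes hF).2.1)
  · rintro ⟨F, hF, rfl⟩
    obtain ⟨L, hL, ⟨e⟩⟩ := classOfSizes_eq hF
    obtain ⟨hr, -, hc, -⟩ := reduced_ofSizes hF
    exact ⟨L, ⟨@isRCBlock_of_orderIso (Fin j) L _ hr e 3 (sum_width_of_core_eq hc),
      (@hasBasicBlock_iff (Fin j) L.toPartialOrder _ hr e i).2 hc⟩, hL.symm⟩

theorem ncard_typedBlockClass (i : Fin 9) (j : ℕ) :
    (typedBlockClass i j).ncard = (sizeFamilies i j).ncard := by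
  rw [typedBlockClass_eq_image]
  exact Set.InjOn.ncard_image fun F hF F' hF' h => classOfSizes_injOn hF hF' h

/-- Among blocks of nullity three, the height of the basic block and its type are both read off from
the core, so `exists_core_eq_iff` applies. -/
theorem blockClass_eq_iUnion (j : ℕ) : blockClass j 4 3 4 = ⋃ i, typedBlockClass i j := by
  have key : ∀ L : Lattice (Fin j), @IsRCBlock (Fin j) L 4 3 →
      (@HasBasicBlockOfHeight (Fin j) L.toPartialOrder 4 ↔
        ∃ i, @HasBasicBlock (Fin j) L.toPartialOrder (HeightFourBlock i) _) := by
    intro L hL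
    obtain ⟨X, hX, ⟨e⟩, hn⟩ := @exists_reduced_orderIso (Fin j) L _ 3 hL
    rw [@hasBasicBlockOfHeight_iff (Fin j) L.toPartialOrder _ hX e 4,
      exists_core_eq_iff hX.touched hn]
    exact exists_congr fun i => (@hasBasicBlock_iff (Fin j) L.toPartialOrder _ hX e i).symm
  ext c
  rw [Set.mem_iUnion]
  constructor
  · rintro ⟨L, ⟨hL, hb⟩, rfl⟩
    obtain ⟨i, hi⟩ := (key L hL).1 hb
    exact ⟨i, L, ⟨hL, hi⟩, rfl⟩
  · rintro ⟨i, L, ⟨hL, hb⟩, rfl⟩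
    exact ⟨L, ⟨hL, (key L hL).2 ⟨i, hb⟩⟩, rfl⟩

theorem disjoint_typedBlockClass (j : ℕ) {i i' : Fin 9} (h : i ≠ i') :
    Disjoint (typedBlockClass i j) (typedBlockClass i' j) := by
  rw [Set.disjoint_left, typedBlockClass_eq_image, typedBlockClass_eq_image]
  rintro _ ⟨F, hF, rfl⟩ ⟨F', hF', heq⟩
  obtain rfl := classOfSizes_injOn hF' hF heq
  exact h (coreType_injective (hF.2.1.symm.trans hF'.2.1))

end Classes

/-! ### Counting -/

section Counting

open PowerSeries

/-- The number of partitions of `n` whose number of parts satisfies `P`. -/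
def partitionCount (P : ℕ → Prop) [DecidablePred P] (n : ℕ) : ℕ :=
  (Finset.univ.filter fun p : n.Partition => P (Multiset.card p.parts)).card

/-- The families of multisets of positive integers with restricted cardinalities and given total
sum are counted by a product of power series. -/
theorem finite_and_ncard_families (P : Fin 6 → ℕ → Prop) [∀ q, DecidablePred (P q)] (n : ℕ) :
    {F : Fin 6 → Multiset ℕ | (∀ q, 0 ∉ F q) ∧ (∀ q, P q (Multiset.card (F q))) ∧
      ∑ q, (F q).sum = n}.Finite ∧
    {F : Fin 6 → Multiset ℕ | (∀ q, 0 ∉ F q) ∧ (∀ q, P q (Multiset.card (F q))) ∧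
      ∑ q, (F q).sum = n}.ncard = coeff n (∏ q, mk (partitionCount (P q)) : ℕ⟦X⟧) := by
  classical
  let A : Fin 6 → ℕ → Finset (Multiset ℕ) := fun q a =>
    (Finset.univ.filter fun p : a.Partition => P q (Multiset.card p.parts)).image
      Nat.Partition.parts
  have hA : ∀ q a m, m ∈ A q a ↔ 0 ∉ m ∧ P q (Multiset.card m) ∧ m.sum = a := by
    intro q a m
    simp only [A, Finset.mem_image, Finset.mem_filter, Finset.mem_univ, true_and]
    constructor
    · rintro ⟨p, hp, rfl⟩
      exact ⟨fun h => (p.parts_pos h).ne rfl, hp, p.parts_sum⟩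
    · rintro ⟨h0, hp, hs⟩
      exact ⟨⟨m, fun {i} hi => Nat.pos_of_ne_zero fun h => h0 (h ▸ hi), hs⟩, hp, rfl⟩
  have hcard : ∀ q a, (A q a).card = partitionCount (P q) a := fun q a =>
    Finset.card_image_of_injective _ fun p p' h => Nat.Partition.ext h
  have hset : {F : Fin 6 → Multiset ℕ | (∀ q, 0 ∉ F q) ∧ (∀ q, P q (Multiset.card (F q))) ∧
      ∑ q, (F q).sum = n} =
      (((Finset.finsuppAntidiag Finset.univ n).biUnion fun a : Fin 6 →₀ ℕ =>
        Fintype.piFinset fun q => A q (a q) : Finset (Fin 6 → Multiset ℕ)) : Set _) := by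
    ext F
    simp only [Set.mem_ofPred_eq, Finset.coe_biUnion, Set.mem_iUnion, Finset.mem_coe,
      Finset.mem_finsuppAntidiag, Fintype.mem_piFinset, hA, exists_prop]
    constructor
    · rintro ⟨h0, hp, hs⟩
      exact ⟨Finsupp.equivFunOnFinite.symm fun q => (F q).sum, ⟨by simpa using hs, by simp⟩,
        fun q => ⟨h0 q, hp q, by simp⟩⟩
    · rintro ⟨a, ⟨ha, -⟩, h⟩
      refine ⟨fun q => (h q).1, fun q => (h q).2.1, ?_⟩
      rw [← ha]
      exact Finset.sum_congr rfl fun q _ => (h q).2.2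
  rw [hset]
  refine ⟨Finset.finite_toSet _, ?_⟩
  rw [Set.ncard_coe_finset, Finset.card_biUnion, coeff_prod]
  · simp only [Fintype.card_piFinset, hcard, coeff_mk]
  · intro a _ b _ hab
    rw [Function.onFun, Finset.disjoint_left]
    intro F ha hb
    refine hab (Finsupp.ext fun q => ?_)
    rw [Fintype.mem_piFinset] at ha hb
    rw [← ((hA _ _ _).1 (ha q)).2.2, ← ((hA _ _ _).1 (hb q)).2.2]

theorem partitionCount_eq (k : ℕ) : partitionCount (· = k) = numPartitions k := rfl

theorem numPartitions_zero : numPartitions 0 = fun n => if n = 0 then 1 else 0 := by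
  funext n
  unfold numPartitions
  split_ifs with h
  · subst h
    rfl
  · rw [Finset.card_eq_zero, Finset.filter_eq_empty_iff]
    intro p _ hp
    rw [Multiset.card_eq_zero] at hp
    have := p.parts_sum
    rw [hp] at this
    exact h this.symm

theorem numPartitions_one : numPartitions 1 = fun n => if n = 0 then 0 else 1 := by
  funext n
  unfold numPartitions
  split_ifs with h
  · subst h
    rfl
  · rw [Finset.card_eq_one]
    refine ⟨⟨{n}, by simp; omega, by simp⟩, ?_⟩
    ext p
    simp only [Finset.mem_filter, Finset.mem_univ, true_and, Finset.mem_singleton]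
    constructor
    · intro hp
      obtain ⟨m, hm⟩ := Multiset.card_eq_one.1 hp
      have := p.parts_sum
      rw [hm, Multiset.sum_singleton] at this
      exact Nat.Partition.ext (hm.trans (by rw [this]))
    · rintro rfl
      rfl

theorem numPartitions_eq_zero_of_lt {k n : ℕ} (h : n < k) : numPartitions k n = 0 := by
  unfold numPartitions
  rw [Finset.card_eq_zero, Finset.filter_eq_empty_iff]
  intro p _ hp
  have h1 : ∀ x ∈ p.parts, 1 ≤ x := fun x hx => p.parts_pos hx
  have := Multiset.card_nsmul_le_sum h1
  rw [p.parts_sum, hp] at this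
  simp at this
  omega

/-- A pair with at most one strand can hold any number n of elements in exactly one way; the case n
= 0 is the absent strand. -/
theorem partitionCount_le_one : partitionCount (· ≤ 1) = fun _ => 1 := by
  funext n
  have h : partitionCount (· ≤ 1) n = numPartitions 0 n + numPartitions 1 n := by
    unfold partitionCount numPartitions
    rw [← Finset.card_union_of_disjoint]
    · congr 1
      ext p
      simp only [Finset.mem_filter, Finset.mem_univ, true_and, Finset.mem_union]
      omega
    · rw [Finset.disjoint_filter]
      intro p _ h
      omega
  rw [h, numPartitions_zero, numPartitions_one]
  dsimp only
  split_ifs <;> rfl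

theorem partitionCount_congr {P Q : ℕ → Prop} [DecidablePred P] [DecidablePred Q]
    (h : ∀ c, P c ↔ Q c) : partitionCount P = partitionCount Q := by
  funext n
  unfold partitionCount
  congr 1
  ext p
  simp [h]

/-- The power series counting the strands that may be absent. -/
def optSeries : ℕ⟦X⟧ := mk fun _ => 1

/-- The power series counting partitions into `k` parts. -/
def partSeries (k : ℕ) : ℕ⟦X⟧ := mk (numPartitions k)

theorem partSeries_zero : partSeries 0 = 1 := by
  ext n
  rw [partSeries, coeff_mk, numPartitions_zero, coeff_one]

theorem partSeries_one : partSeries 1 = X * optSeries := by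
  ext n
  rw [partSeries, coeff_mk, numPartitions_one]
  cases n with
  | zero => simp
  | succ n => simp [optSeries, coeff_succ_X_mul]

/-- The factor of the generating function for a pair of nodes. -/
theorem mk_partitionCount_core (i : Fin 9) (q : Fin 6) :
    mk (partitionCount fun c => (if 3 ≤ q ∨ 2 ≤ c then c else 0) = coreType i q) =
      if ¬ 3 ≤ q ∧ coreType i q = 0 then optSeries else partSeries (coreType i q) := by
  -- The core of a consecutive pair is never 1, so a nonzero value is attained only when the number
  -- of strands equals it.
  have hne : ∀ i (q : Fin 6), ¬ 3 ≤ q → coreType i q ≠ 1 := by decide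
  have hne := hne i q
  split_ifs with h
  · rw [optSeries, ← partitionCount_le_one]
    congr 1
    refine partitionCount_congr fun c => ?_
    rw [h.2]
    split_ifs with hc
    · have := hc.resolve_left h.1
      omega
    · have : ¬ 2 ≤ c := fun h' => hc (.inr h')
      omega
  · rw [partSeries, ← partitionCount_eq]
    congr 1
    refine partitionCount_congr fun c => ?_
    by_cases h3 : 3 ≤ q
    · simp [h3]
    · simp only [h3, not_false_eq_true, true_and, false_or, forall_true_left] at *
      split_ifs <;> omega

theorem finite_and_ncard_sizeFamilies (i : Fin 9) {j : ℕ} (hj : 4 ≤ j) :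
    (sizeFamilies i j).Finite ∧ (sizeFamilies i j).ncard = coeff (j - 4) (∏ q : Fin 6,
      if ¬ 3 ≤ q ∧ coreType i q = 0 then optSeries else partSeries (coreType i q)) := by
  have h := finite_and_ncard_families
    (fun q c => (if 3 ≤ q ∨ 2 ≤ c then c else 0) = coreType i q) (j - 4)
  have hset : sizeFamilies i j = {F : Fin 6 → Multiset ℕ | (∀ q, 0 ∉ F q) ∧
      (∀ q, (if 3 ≤ q ∨ 2 ≤ Multiset.card (F q) then Multiset.card (F q) else 0) = coreType i q) ∧
      ∑ q, (F q).sum = j - 4} := by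
    ext F
    simp only [sizeFamilies, Set.mem_ofPred_eq, funext_iff, core]
    refine and_congr_right fun _ => and_congr_right fun _ => ?_
    omega
  rw [hset]
  refine ⟨h.1, h.2.trans ?_⟩
  simp only [mk_partitionCount_core]

/-- In each of the last seven types one pair has two core strands, two pairs have one each, and two
consecutive pairs are optional; the types differ only in which pairs these are. -/
theorem sum_ncard_sizeFamilies {j : ℕ} (hj : 4 ≤ j) :
    ∑ i, (sizeFamilies i j).ncard =
      coeff (j - 4) (optSeries ^ 2 * partSeries 3 * partSeries 1) +
      coeff (j - 4) (optSeries ^ 2 * partSeries 2 * partSeries 2) +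
      7 * coeff (j - 4) (optSeries ^ 2 * partSeries 2 * partSeries 1 ^ 2) := by
  have h0 : (sizeFamilies 0 j).ncard =
      coeff (j - 4) (optSeries ^ 2 * partSeries 3 * partSeries 1) := by
    rw [(finite_and_ncard_sizeFamilies 0 hj).2, Fin.prod_univ_six]
    refine congrArg (coeff (j - 4)) ?_
    simp [coreType, partSeries_zero]
    ring
  have h1 : (sizeFamilies 1 j).ncard =
      coeff (j - 4) (optSeries ^ 2 * partSeries 2 * partSeries 2) := by
    rw [(finite_and_ncard_sizeFamilies 1 hj).2, Fin.prod_univ_six]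
    refine congrArg (coeff (j - 4)) ?_
    simp [coreType, partSeries_zero]
    ring
  have h2 : ∀ i : Fin 7, (sizeFamilies i.succ.succ j).ncard =
      coeff (j - 4) (optSeries ^ 2 * partSeries 2 * partSeries 1 ^ 2) := by
    intro i
    rw [(finite_and_ncard_sizeFamilies _ hj).2, Fin.prod_univ_six]
    refine congrArg (coeff (j - 4)) ?_
    fin_cases i <;> simp [coreType, partSeries_zero] <;> ring
  rw [Fin.sum_univ_succ, Fin.sum_univ_succ, h0, Finset.sum_congr rfl fun i _ => h2 i]
  change _ + ((sizeFamilies 1 j).ncard + _) = _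
  rw [h1]
  simp [add_assoc]

theorem coeff_mk_mul (f : ℕ → ℕ) (φ : ℕ⟦X⟧) (n : ℕ) :
    coeff n (mk f * φ) = ∑ a ∈ Finset.range (n + 1), f a * coeff (n - a) φ := by
  rw [coeff_mul, Finset.Nat.sum_antidiagonal_eq_sum_range_succ_mk]
  simp

theorem sum_range_eq_sum_Icc {f : ℕ → ℕ} {a b n : ℕ} (hb : b ≤ n)
    (hf : ∀ t ≤ n, (t < a ∨ b < t) → f t = 0) :
    ∑ t ∈ Finset.range (n + 1), f t = ∑ t ∈ Finset.Icc a b, f t := by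
  symm
  apply Finset.sum_subset
  · intro t
    simp only [Finset.mem_Icc, Finset.mem_range]
    omega
  · intro t ht ht'
    simp only [Finset.mem_Icc, Finset.mem_range] at ht ht'
    exact hf t (by omega) (by omega)

theorem coeff_partSeries_one_mul (φ : ℕ⟦X⟧) {n b : ℕ} (hb : b ≤ n)
    (h : ∀ t, b < t → t ≤ n → coeff (n - t) φ = 0) :
    coeff n (partSeries 1 * φ) = ∑ t ∈ Finset.Icc 1 b, coeff (n - t) φ := by
  rw [partSeries, coeff_mk_mul, sum_range_eq_sum_Icc (a := 1) hb]
  · refine Finset.sum_congr rfl fun t ht => ?_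
    rw [Finset.mem_Icc] at ht
    rw [numPartitions_one]
    simp [show t ≠ 0 by omega]
  · rintro t ht (h0 | hlt)
    · obtain rfl : t = 0 := by omega
      simp [numPartitions_one]
    · rw [h t hlt ht, mul_zero]

theorem X_dvd_partSeries (k : ℕ) : X ^ k ∣ partSeries k := by
  rw [X_pow_dvd_iff]
  intro m hm
  rw [partSeries, coeff_mk, numPartitions_eq_zero_of_lt hm]

theorem optSeries_sq : optSeries ^ 2 = mk fun n => n + 1 := by
  ext n
  rw [pow_two]
  conv_lhs => rw [optSeries, coeff_mk_mul]
  simp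

theorem coeff_eq_zero_of_X_pow_dvd {φ : ℕ⟦X⟧} {k n : ℕ} (h : X ^ k ∣ φ) (hn : n < k) :
    coeff n φ = 0 := X_pow_dvd_iff.1 h n hn

/-! ### The three coefficients as nested sums -/

theorem coeff_opt_sq_mul_part_three_mul_part_one {j : ℕ} (hj : 8 ≤ j) :
    coeff (j - 4) (optSeries ^ 2 * partSeries 3 * partSeries 1) =
      ∑ t ∈ Finset.Icc 1 (j - 7), ∑ i ∈ Finset.Icc 2 (j - t - 5),
        (i - 1) * numPartitions 3 (j - t - i - 2) := by
  -- With two extra units, so that both optional strands become nonempty, i elements split in i - 1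
  -- ways. This shifts the degree from j - 4 to j - 2.
  have hsq : X ^ 2 * optSeries ^ 2 = mk fun n => n - 1 := by
    ext n
    rw [coeff_X_pow_mul', optSeries_sq]
    simp only [coeff_mk]
    split_ifs <;> omega
  have h1 : coeff (j - 4) (optSeries ^ 2 * partSeries 3 * partSeries 1) =
      coeff (j - 2) (partSeries 1 * ((mk fun n => n - 1) * partSeries 3)) := by
    rw [← hsq, show partSeries 1 * (X ^ 2 * optSeries ^ 2 * partSeries 3) =
      X ^ 2 * (optSeries ^ 2 * partSeries 3 * partSeries 1) by ring,
      show j - 2 = j - 4 + 2 by omega, coeff_X_pow_mul]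
  -- Vanishing in degrees below 5 is what stops `t` at j - 7.
  have hdvd : X ^ 5 ∣ (mk fun n => n - 1) * partSeries 3 := by
    rw [← hsq, mul_assoc, show (X : ℕ⟦X⟧) ^ 5 = X ^ 2 * X ^ 3 by ring]
    exact mul_dvd_mul_left _ (Dvd.dvd.mul_left (X_dvd_partSeries 3) _)
  rw [h1, coeff_partSeries_one_mul _ (b := j - 7) (by omega)
    fun t h1 h2 => coeff_eq_zero_of_X_pow_dvd hdvd (by omega)]
  refine Finset.sum_congr rfl fun t ht => ?_
  rw [Finset.mem_Icc] at ht
  rw [coeff_mk_mul, sum_range_eq_sum_Icc (a := 2) (b := j - t - 5) (by omega)]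
  · refine Finset.sum_congr rfl fun i hi => ?_
    rw [partSeries, coeff_mk, show j - 2 - t - i = j - t - i - 2 by omega]
  · rintro i hi (h | h)
    · rw [show i - 1 = 0 by omega, zero_mul]
    · rw [partSeries, coeff_mk, numPartitions_eq_zero_of_lt (by omega), mul_zero]

/-- The degree is shifted by 3: one unit goes to the optional strands, which turns the coefficient n
+ 1 into `t`, and two go to one of the partition factors, which explains `p - 2` and the start at p
= 4. -/
theorem coeff_opt_sq_mul_part_two_sq {j : ℕ} (hj : 8 ≤ j) :
    coeff (j - 4) (optSeries ^ 2 * partSeries 2 * partSeries 2) =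
      ∑ p ∈ Finset.Icc 4 (j - 4), ∑ t ∈ Finset.Icc 1 (j - p - 3),
          t * numPartitions 2 (j - p - t - 1) * numPartitions 2 (p - 2) := by
  have hsq : X * optSeries ^ 2 = mk fun n => n := by
    ext n
    rw [optSeries_sq]
    cases n <;> simp [coeff_succ_X_mul]
  have hpart : X ^ 2 * partSeries 2 = mk fun n => numPartitions 2 (n - 2) := by
    ext n
    rw [coeff_X_pow_mul', partSeries]
    simp only [coeff_mk]
    split_ifs
    · rfl
    · rw [numPartitions_eq_zero_of_lt (by omega)]
  have h1 : coeff (j - 4) (optSeries ^ 2 * partSeries 2 * partSeries 2) =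
      coeff (j - 1) ((mk fun n => numPartitions 2 (n - 2)) * ((mk fun n => n) * partSeries 2)) := by
    rw [← hsq, ← hpart, show X ^ 2 * partSeries 2 * (X * optSeries ^ 2 * partSeries 2) =
      X ^ 3 * (optSeries ^ 2 * partSeries 2 * partSeries 2) by ring,
      show j - 1 = j - 4 + 3 by omega, coeff_X_pow_mul]
  have hdvd : X ^ 3 ∣ (mk fun n => n) * partSeries 2 := by
    rw [← hsq, mul_assoc, show (X : ℕ⟦X⟧) ^ 3 = X * X ^ 2 by ring]
    exact mul_dvd_mul_left _ (Dvd.dvd.mul_left (X_dvd_partSeries 2) _)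
  rw [h1, coeff_mk_mul, sum_range_eq_sum_Icc (a := 4) (b := j - 4) (by omega)]
  · refine Finset.sum_congr rfl fun p hp => ?_
    rw [Finset.mem_Icc] at hp
    rw [coeff_mk_mul, sum_range_eq_sum_Icc (a := 1) (b := j - p - 3) (by omega), Finset.mul_sum]
    · refine Finset.sum_congr rfl fun t ht => ?_
      rw [partSeries, coeff_mk, show j - 1 - p - t = j - p - t - 1 by omega]
      ring
    · rintro t ht (h | h)
      · rw [show t = 0 by omega, zero_mul]
      · rw [partSeries, coeff_mk, numPartitions_eq_zero_of_lt (by omega), mul_zero]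
  · rintro p hp (h | h)
    · rw [numPartitions_eq_zero_of_lt (by omega), zero_mul]
    · rw [coeff_eq_zero_of_X_pow_dvd hdvd (by omega), mul_zero]

/-- Since `X * optSeries = partSeries 1`, a shift by 2 turns the two optional strands into nonempty
ones. The summation variables are then the sizes of four nonempty strands, and each upper bound
leaves enough room for the remaining factors. -/
theorem coeff_opt_sq_mul_part_two_mul_part_one_sq {j : ℕ} (hj : 8 ≤ j) :
    coeff (j - 4) (optSeries ^ 2 * partSeries 2 * partSeries 1 ^ 2) =
      ∑ t ∈ Finset.Icc 1 (j - 7), ∑ r ∈ Finset.Icc 1 (j - t - 6), ∑ l ∈ Finset.Icc 1 (j - t - r - 5),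
          ∑ i ∈ Finset.Icc 1 (j - t - r - l - 4), numPartitions 2 (j - t - r - l - i - 2) := by
  have h1 : coeff (j - 4) (optSeries ^ 2 * partSeries 2 * partSeries 1 ^ 2) =
      coeff (j - 2) (partSeries 1 * (partSeries 1 * (partSeries 1 *
        (partSeries 1 * partSeries 2)))) := by
    rw [show partSeries 1 * (partSeries 1 * (partSeries 1 * (partSeries 1 * partSeries 2))) =
      (partSeries 1 * partSeries 1) * partSeries 2 * partSeries 1 ^ 2 by ring]
    nth_rewrite 2 [partSeries_one]
    nth_rewrite 2 [partSeries_one]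
    rw [show X * optSeries * (X * optSeries) * partSeries 2 * partSeries 1 ^ 2 =
      X ^ 2 * (optSeries ^ 2 * partSeries 2 * partSeries 1 ^ 2) by ring,
      show j - 2 = j - 4 + 2 by omega, coeff_X_pow_mul]
  have d2 := X_dvd_partSeries 2
  have d1 : ∀ {k : ℕ} {φ : ℕ⟦X⟧}, X ^ k ∣ φ → X ^ (k + 1) ∣ partSeries 1 * φ := fun h => by
    rw [pow_succ', partSeries_one, mul_assoc]
    exact mul_dvd_mul_left _ (Dvd.dvd.mul_left h _)
  have d3 := d1 d2
  have d4 := d1 d3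
  have d5 := d1 d4
  rw [h1, coeff_partSeries_one_mul _ (b := j - 7) (by omega)
    fun t h1 h2 => coeff_eq_zero_of_X_pow_dvd d5 (by omega)]
  refine Finset.sum_congr rfl fun t ht => ?_
  rw [Finset.mem_Icc] at ht
  rw [coeff_partSeries_one_mul _ (b := j - t - 6) (by omega)
    fun t h1 h2 => coeff_eq_zero_of_X_pow_dvd d4 (by omega)]
  refine Finset.sum_congr rfl fun r hr => ?_
  rw [Finset.mem_Icc] at hr
  rw [coeff_partSeries_one_mul _ (b := j - t - r - 5) (by omega)
    fun t h1 h2 => coeff_eq_zero_of_X_pow_dvd d3 (by omega)]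
  refine Finset.sum_congr rfl fun l hl => ?_
  rw [Finset.mem_Icc] at hl
  rw [coeff_partSeries_one_mul _ (b := j - t - r - l - 4) (by omega)
    fun t h1 h2 => coeff_eq_zero_of_X_pow_dvd d2 (by omega)]
  refine Finset.sum_congr rfl fun i hi => ?_
  rw [partSeries, coeff_mk, show j - 2 - t - r - l - i = j - t - r - l - i - 2 by omega]

end Counting

/-! ### Assembling the count -/

theorem finite_typedBlockClass (i : Fin 9) {j : ℕ} (hj : 4 ≤ j) : (typedBlockClass i j).Finite := by
  rw [typedBlockClass_eq_image]
  exact (finite_and_ncard_sizeFamilies i hj).1.image _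

/-- The nine classes are disjoint because the core determines the type. Their finiteness is needed
for `Set.ncard` to be additive. -/
theorem ncard_blockClass {j : ℕ} (hj : 4 ≤ j) :
    (blockClass j 4 3 4).ncard = ∑ i : Fin 9, (typedBlockClass i j).ncard := by
  rw [blockClass_eq_iUnion, ← finsum_eq_sum_of_fintype,
    Set.ncard_iUnion_of_finite (fun i => finite_typedBlockClass i hj)
      fun i i' h => disjoint_typedBlockClass j h]

theorem mainTheorem4 (j : ℕ) (hj : 8 ≤ j) :
    (blockClass j 4 3 4).ncard = ∑ i : Fin 9, (typedBlockClass i j).ncard ∧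
    ∑ i : Fin 9, (typedBlockClass i j).ncard =
      ∑ t ∈ Finset.Icc 1 (j - 7), ∑ i ∈ Finset.Icc 2 (j - t - 5), (i - 1) * numPartitions 3 (j - t - i - 2)
      + ∑ p ∈ Finset.Icc 4 (j - 4), ∑ t ∈ Finset.Icc 1 (j - p - 3),
          t * numPartitions 2 (j - p - t - 1) * numPartitions 2 (p - 2)
      + ∑ t ∈ Finset.Icc 1 (j - 7), ∑ r ∈ Finset.Icc 1 (j - t - 6), ∑ l ∈ Finset.Icc 1 (j - t - r - 5),
          ∑ i ∈ Finset.Icc 1 (j - t - r - l - 4), 7 * numPartitions 2 (j - t - r - l - i - 2) := by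
  refine ⟨ncard_blockClass (by omega), ?_⟩
  simp only [ncard_typedBlockClass, ← Finset.mul_sum]
  rw [sum_ncard_sizeFamilies (by omega), coeff_opt_sq_mul_part_three_mul_part_one hj,
    coeff_opt_sq_mul_part_two_sq hj, coeff_opt_sq_mul_part_two_mul_part_one_sq hj]
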